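/- Theorem (Janssen–Ron–Shen duality for superframes). For $z=(x,\xi)\in\mathbb{R}^d\times\mathbb{R}^d$ let $\pi_z f(t)=e^{2\pi i\,\xi\cdot t}f(t-x)$ denote the time-frequency shift, acting coordinate-wise on vector-valued functions. Let $\Lambda\subset\mathbb{R}^{2d}$ be a lattice, i.e. $\Lambda=A\mathbb{Z}^{2d}$ with $A$ a non-singular real $2d\times 2d$ matrix, and let $\Lambda^\circ=\{\mu\in\mathbb{R}^{2d}:\pi_\lambda\pi_\mu=\pi_\mu\pi_\lambda \text{ on } L^2(\mathbb{R}^d)\text{ for all }\lambda\in\Lambda\}$ be its adjoint lattice. Let $\mathbf{g}=(g_1,\dots,g_n)\in L^2(\mathbb{R}^d,\mathbb{C}^n)$. Then the following are equivalent: (i) The Gabor system $\mathcal{G}(\mathbf{g},\Lambda)=\{\pi_\lambda\mathbf{g}:\lambda\in\Lambda\}$ is a frame for $L^2(\mathbb{R}^d,\mathbb{C}^n)$: there are constants $A,B>0$ such that $$A\|\mathbf{f}\|^2\le\sum_{\lambda\in\Lambda}|\langle\mathbf{f},\pi_\lambda\mathbf{g}\rangle|^2\le B\|\mathbf{f}\|^2\qquad\text{for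 all }\mathbf{f}\in L^2(\mathbb{R}^d,\mathbb{C}^n).$$ (ii) The union $\bigcup_{j=1}^n\mathcal{G}(g_j,\Lambda^\circ)$, understood as the family $(\pi_\mu g_j)$ indexed by $(j,\mu)\in\{1,\dots,n\}\times\Lambda^\circ$, is a Riesz sequence in $L^2(\mathbb{R}^d)$: there are constants $A',B'>0$ such that $$A'\sum_{j,\mu}|c_{j,\mu}|^2\le\Big\|\sum_{j=1}^n\sum_{\mu\in\Lambda^\circ}c_{j,\mu}\,\pi_\mu g_j\Big\|_2^2\le B'\sum_{j,\mu}|c_{j,\mu}|^2$$ for all finitely supported complex families $(c_{j,\mu})$. -/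

import Mathlib

open MeasureTheory

noncomputable section

namespace GaborDuality

/-- The time-frequency plane `ℝ^d × ℝ^d = ℝ^{2d}`; a point is written `z = (x, ξ)`. -/
abbrev PhaseSpace (d : ℕ) : Type :=
  EuclideanSpace ℝ (Fin d) × EuclideanSpace ℝ (Fin d)

/-- `L²(ℝ^d, E)` with respect to Lebesgue measure. The scalar space `L²(ℝ^d)` is `E = ℂ`, and
`L²(ℝ^d, ℂ^n)` is `E = EuclideanSpace ℂ (Fin n)`. -/
abbrev L2 (d : ℕ) (E : Type) [NormedAddCommGroup E] : Type :=
  Lp E 2 (volume : Measure (EuclideanSpace ℝ (Fin d)))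

section TimeFrequencyShift

variable {d : ℕ} {E : Type} [NormedAddCommGroup E] [NormedSpace ℂ E]

/-- The pointwise formula `t ↦ e^{2πi ξ·t} f(t - x)`, for `z = (x, ξ)`. -/
def shiftFun (z : PhaseSpace d) (f : EuclideanSpace ℝ (Fin d) → E) :
    EuclideanSpace ℝ (Fin d) → E :=
  fun t => Complex.exp (2 * Real.pi * Complex.I * ((inner ℝ z.2 t : ℝ) : ℂ)) • f (t - z.1)

theorem memLp_shiftFun (z : PhaseSpace d) {f : EuclideanSpace ℝ (Fin d) → E}
    (hf : MemLp f 2 volume) : MemLp (shiftFun z f) 2 volume := by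
  have h1 : MemLp (fun t => f (t - z.1)) 2 volume :=
    hf.comp_measurePreserving (measurePreserving_sub_right volume z.1)
  refine h1.of_le (f := shiftFun z f) ?_ (Filter.Eventually.of_forall fun t => ?_)
  · refine AEStronglyMeasurable.smul (Continuous.aestronglyMeasurable ?_) h1.1
    fun_prop
  · have h2 : (2 * Real.pi * Complex.I * ((inner ℝ z.2 t : ℝ) : ℂ))
        = ((2 * Real.pi * inner ℝ z.2 t : ℝ) : ℂ) * Complex.I := by
      push_cast; ring
    simp only [shiftFun, h2, norm_smul, Complex.norm_exp_ofReal_mul_I, one_mul, le_refl]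

/-- The time-frequency shift `π_z` on `L²(ℝ^d, E)`: `π_z f (t) = e^{2πi ξ·t} f(t - x)`
for `z = (x, ξ)`. On vector-valued functions it acts coordinate-wise. -/
def tfShift (z : PhaseSpace d) (f : L2 d E) : L2 d E :=
  (memLp_shiftFun z (Lp.memLp f)).toLp (shiftFun z f)

theorem coeFn_tfShift (z : PhaseSpace d) (f : L2 d E) :
    tfShift z f =ᵐ[volume] fun t =>
      Complex.exp (2 * Real.pi * Complex.I * ((inner ℝ z.2 t : ℝ) : ℂ)) • f (t - z.1) :=
  (memLp_shiftFun z (Lp.memLp f)).coeFn_toLp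

end TimeFrequencyShift

/-- The Gabor system `G(g, S) = {π_z g : z ∈ S}` over a set `S` of the time-frequency plane,
as a family indexed by `S`. -/
def gaborSystem {d : ℕ} {E : Type} [NormedAddCommGroup E] [NormedSpace ℂ E]
    (g : L2 d E) (S : Set (PhaseSpace d)) : S → L2 d E :=
  fun z => tfShift (z : PhaseSpace d) g

/-- The adjoint `Λ° = {μ : π_λ π_μ = π_μ π_λ for all λ ∈ Λ}`, where the time-frequency shifts
are operators on `L²(ℝ^d)`. -/
def adjointLattice {d : ℕ} (Λ : Set (PhaseSpace d)) : Set (PhaseSpace d) :=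
  {μ | ∀ l ∈ Λ, ∀ f : L2 d ℂ, tfShift l (tfShift μ f) = tfShift μ (tfShift l f)}

/-- The `j`-th component `g_j ∈ L²(ℝ^d)` of `g ∈ L²(ℝ^d, ℂ^n)`. -/
def component {d n : ℕ} (g : L2 d (EuclideanSpace ℂ (Fin n))) (j : Fin n) : L2 d ℂ :=
  (EuclideanSpace.proj j : EuclideanSpace ℂ (Fin n) →L[ℂ] ℂ).compLp g

section Hilbert

variable {ι H : Type*} [NormedAddCommGroup H] [InnerProductSpace ℂ H]

/-- A family `φ` is a frame for `H`: there are `A, B > 0` such that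
`A ‖f‖² ≤ ∑ᵢ |⟨f, φᵢ⟩|² ≤ B ‖f‖²` for all `f ∈ H` (the series converging). -/
def IsFrame (φ : ι → H) : Prop :=
  ∃ A B : ℝ, 0 < A ∧ 0 < B ∧ ∀ f : H,
    Summable (fun i => ‖inner ℂ (φ i) f‖ ^ 2) ∧
    A * ‖f‖ ^ 2 ≤ ∑' i, ‖inner ℂ (φ i) f‖ ^ 2 ∧
    ∑' i, ‖inner ℂ (φ i) f‖ ^ 2 ≤ B * ‖f‖ ^ 2

/-- A family `φ` is a Riesz sequence in `H`: there are `A, B > 0` such that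
`A ∑ᵢ |cᵢ|² ≤ ‖∑ᵢ cᵢ φᵢ‖² ≤ B ∑ᵢ |cᵢ|²` for all finitely supported scalar families `c`. -/
def IsRieszSequence (φ : ι → H) : Prop :=
  ∃ A B : ℝ, 0 < A ∧ 0 < B ∧ ∀ c : ι →₀ ℂ,
    A * ∑ i ∈ c.support, ‖c i‖ ^ 2 ≤ ‖∑ i ∈ c.support, c i • φ i‖ ^ 2 ∧
    ‖∑ i ∈ c.support, c i • φ i‖ ^ 2 ≤ B * ∑ i ∈ c.support, ‖c i‖ ^ 2

end Hilbert

end GaborDuality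

end

noncomputable section

namespace GaborDuality

open scoped ComplexConjugate ENNReal FourierTransform

/-! Two shifts commute up to a scalar: `π_z π_w = e^{2πi ω(z,w)} π_w π_z`, with `ω` the symplectic
form. Hence `Λ°` is the symplectic dual of `Λ`, and the characters `z ↦ e^{2πi ω(z,w)}`, `w ∈ Λ°`,
are those of the torus `ℝ^{2d}/Λ`. Both directions combine Fourier analysis on this torus with the
orthogonality relations of the short-time Fourier transform (`integral_inner_mul_conj`).

Frame to Riesz sequence. Let `G = ∑ c_i π_{w_i} g_{j_i}` be a finite sum over `Λ°`, and let `‖φ‖ =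
1`. The frame inequality is applied to the vector `f_z` with components `∑_{j_i = k} c̄_i π_{w_i}^*
π_z φ`, and integrated over a fundamental domain. Since the `π_{w_i}` commute with `π_l` for `l ∈
Λ`, the frame coefficients of `f_z` are `⟨π_l G, π_z φ⟩`, and their squares integrate to `‖G‖²`.
Orthogonality of the characters turns the integral of `‖f_z‖²` into `vol · ∑ |c_i|²`. The frame
bounds thus become Riesz bounds, multiplied by the volume (`le_enorm_sum_tfShift`,
`enorm_sum_tfShift_le`).

Riesz sequence to frame. A lower Riesz bound yields windows `γ_j` with `⟨γ_j, π_w g_k⟩ = δ_{jk}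
δ_{w0}` whose systems over `Λ°` are Bessel (`exists_dual_windows`). The averaging argument in the
reverse direction makes all the systems Bessel over `Λ` (`exists_isBessel_of_symplDual`). The
function `z ↦ ∑_l ⟨π_l γ, π_{-z} f⟩ conj ⟨π_l g, π_{-z} h⟩` is continuous and `Λ`-periodic, and
biorthogonality kills all its nonconstant Fourier coefficients. Its value at `0` is therefore its
mean, a multiple of `⟨h, f⟩⟨γ, g⟩` (`exists_wexlerRaz_constant`). Consequently the analysis
sequences `u` and `w` of `f` for `g` and `γ` satisfy `⟨u, w⟩ = c‖f‖²`, and Cauchy–Schwarz gives the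
lower frame bound. -/

/-- The character `r ↦ e^{2πi r}` of `ℝ`. -/
def char (r : ℝ) : ℂ := Complex.exp (2 * Real.pi * Complex.I * (r : ℂ))

theorem char_eq_fourierChar (r : ℝ) : char r = (Real.fourierChar r : ℂ) := by
  rw [char, Real.fourierChar_apply]; push_cast; ring_nf

@[simp] theorem char_zero : char 0 = 1 := by simp [char]

theorem char_add (r s : ℝ) : char (r + s) = char r * char s := by
  simp only [char, Complex.ofReal_add, mul_add, Complex.exp_add]

@[simp] theorem norm_char (r : ℝ) : ‖char r‖ = 1 := by
  rw [char_eq_fourierChar]; exact Circle.norm_coe _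

theorem char_neg (r : ℝ) : char (-r) = conj (char r) := by
  simp only [char_eq_fourierChar, AddChar.map_neg_eq_inv, Circle.coe_inv_eq_conj]

theorem char_mul_conj (r : ℝ) : char r * conj (char r) = 1 := by
  rw [← char_neg, ← char_add]; simp

theorem char_eq_one_iff (r : ℝ) : char r = 1 ↔ ∃ k : ℤ, r = k := by
  rw [char, Complex.exp_eq_one_iff]
  have h : (2 * Real.pi * Complex.I) ≠ 0 := Complex.two_pi_I_ne_zero
  refine exists_congr fun k => ?_
  rw [mul_comm, mul_left_inj' h]
  norm_cast

@[fun_prop]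
theorem continuous_char : Continuous char := by
  unfold char; fun_prop

/-- The symplectic form `ω((x, ξ), (y, η)) = ξ·y - η·x` on the time-frequency plane. -/
def sympl {d : ℕ} (z w : PhaseSpace d) : ℝ := inner ℝ z.2 w.1 - inner ℝ w.2 z.1

section

variable {d : ℕ}

theorem sympl_swap (z w : PhaseSpace d) : sympl z w = -sympl w z := by simp [sympl]

theorem sympl_add_left (z w v : PhaseSpace d) : sympl (z + w) v = sympl z v + sympl w v := by
  simp only [sympl, Prod.fst_add, Prod.snd_add, inner_add_left, inner_add_right]; ring

theorem sympl_add_right (z w v : PhaseSpace d) : sympl z (w + v) = sympl z w + sympl z v := by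
  simp only [sympl, Prod.fst_add, Prod.snd_add, inner_add_left, inner_add_right]; ring

theorem sympl_smul_left (r : ℝ) (z w : PhaseSpace d) : sympl (r • z) w = r * sympl z w := by
  simp only [sympl, Prod.smul_fst, Prod.smul_snd, real_inner_smul_left, real_inner_smul_right]; ring

theorem sympl_smul_right (r : ℝ) (z w : PhaseSpace d) : sympl z (r • w) = r * sympl z w := by
  simp only [sympl, Prod.smul_fst, Prod.smul_snd, real_inner_smul_left, real_inner_smul_right]; ring

@[fun_prop]
theorem continuous_sympl_left (w : PhaseSpace d) : Continuous fun z => sympl z w := by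
  unfold sympl; fun_prop

end

/-! ### Algebra of time-frequency shifts -/

section Shift

variable {d : ℕ} {E : Type} [NormedAddCommGroup E] [NormedSpace ℂ E]

theorem coeFn_tfShift' (z : PhaseSpace d) (f : L2 d E) :
    tfShift z f =ᵐ[volume] fun t => char (inner ℝ z.2 t) • f (t - z.1) :=
  coeFn_tfShift z f

theorem tfShift_add (z : PhaseSpace d) (f g : L2 d E) :
    tfShift z (f + g) = tfShift z f + tfShift z g := by
  apply Lp.ext
  have h := (measurePreserving_sub_right (volume : Measure (EuclideanSpace ℝ (Fin d)))
    z.1).quasiMeasurePreserving.ae_eq_comp (Lp.coeFn_add f g)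
  filter_upwards [coeFn_tfShift' z (f + g), coeFn_tfShift' z f, coeFn_tfShift' z g,
    Lp.coeFn_add (tfShift z f) (tfShift z g), h] with t h1 h2 h3 h4 h5
  simp only [Function.comp_apply, Pi.add_apply] at h5
  rw [h1, h4, Pi.add_apply, h2, h3, h5, smul_add]

theorem tfShift_smul (z : PhaseSpace d) (c : ℂ) (f : L2 d E) :
    tfShift z (c • f) = c • tfShift z f := by
  apply Lp.ext
  have h := (measurePreserving_sub_right (volume : Measure (EuclideanSpace ℝ (Fin d)))
    z.1).quasiMeasurePreserving.ae_eq_comp (Lp.coeFn_smul c f)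
  filter_upwards [coeFn_tfShift' z (c • f), coeFn_tfShift' z f,
    Lp.coeFn_smul c (tfShift z f), h] with t h1 h2 h4 h5
  simp only [Function.comp_apply, Pi.smul_apply] at h5
  rw [h1, h4, Pi.smul_apply, h2, h5, smul_comm]

theorem norm_tfShift (z : PhaseSpace d) (f : L2 d E) : ‖tfShift z f‖ = ‖f‖ := by
  have hp := measurePreserving_sub_right (volume : Measure (EuclideanSpace ℝ (Fin d))) z.1
  rw [Lp.norm_def, Lp.norm_def, ← eLpNorm_comp_measurePreserving (Lp.aestronglyMeasurable f) hp]
  congr 1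
  apply eLpNorm_congr_norm_ae
  filter_upwards [coeFn_tfShift' z f] with t h1
  rw [h1, norm_smul, norm_char, one_mul, Function.comp_apply]

/-- The time-frequency shift `π_z` as a linear isometry of `L²(ℝ^d, E)`. -/
def tfIsom (z : PhaseSpace d) : L2 d E →ₗᵢ[ℂ] L2 d E where
  toFun := tfShift z
  map_add' := tfShift_add z
  map_smul' := tfShift_smul z
  norm_map' := norm_tfShift z

@[simp] theorem tfIsom_apply (z : PhaseSpace d) (f : L2 d E) : tfIsom z f = tfShift z f := rfl

theorem tfShift_sum {ι : Type*} (z : PhaseSpace d) (s : Finset ι) (f : ι → L2 d E) :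
    tfShift z (∑ i ∈ s, f i) = ∑ i ∈ s, tfShift z (f i) :=
  map_sum (tfIsom z) f s

theorem tfShift_tfShift (z w : PhaseSpace d) (f : L2 d E) :
    tfShift z (tfShift w f) = char (-inner ℝ w.2 z.1) • tfShift (z + w) f := by
  apply Lp.ext
  have h := (measurePreserving_sub_right (volume : Measure (EuclideanSpace ℝ (Fin d)))
    z.1).quasiMeasurePreserving.ae_eq_comp (coeFn_tfShift' w f)
  filter_upwards [coeFn_tfShift' z (tfShift w f), coeFn_tfShift' (z + w) f,
    Lp.coeFn_smul (char (-inner ℝ w.2 z.1)) (tfShift (z + w) f), h] with t h1 h2 h4 h5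
  simp only [Function.comp_apply] at h5
  rw [h1, h4, Pi.smul_apply, h2, h5, smul_smul, smul_smul, ← char_add, ← char_add]
  congr 2
  · simp only [Prod.snd_add, inner_add_left, inner_sub_right]; ring
  · exact sub_sub _ _ _

theorem tfShift_zero (f : L2 d E) : tfShift 0 f = f := by
  apply Lp.ext
  filter_upwards [coeFn_tfShift' 0 f] with t h1
  rw [h1]; simp

theorem tfShift_comm (z w : PhaseSpace d) (f : L2 d E) :
    tfShift z (tfShift w f) = char (sympl z w) • tfShift w (tfShift z f) := by
  rw [tfShift_tfShift, tfShift_tfShift, smul_smul, ← char_add, add_comm w z, sympl]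
  congr 2; ring

theorem tfShift_neg_tfShift (z : PhaseSpace d) (f : L2 d E) :
    tfShift (-z) (tfShift z f) = char (inner ℝ z.2 z.1) • f := by
  rw [tfShift_tfShift, neg_add_cancel, tfShift_zero]; simp

end Shift

section Inner

variable {d : ℕ} {E : Type} [NormedAddCommGroup E] [InnerProductSpace ℂ E]

theorem inner_tfShift_tfShift (z : PhaseSpace d) (f g : L2 d E) :
    inner ℂ (tfShift z f) (tfShift z g) = inner ℂ f g :=
  (tfIsom z).inner_map_map f g

/-- The adjoint of `π_z` is a multiple of `π_{-z}`. -/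
theorem inner_tfShift_left (z : PhaseSpace d) (f g : L2 d E) :
    inner ℂ (tfShift z f) g = char (-inner ℝ z.2 z.1) * inner ℂ f (tfShift (-z) g) := by
  rw [← inner_tfShift_tfShift (-z), tfShift_neg_tfShift, inner_smul_left, char_neg]

theorem inner_tfShift_add (z w : PhaseSpace d) (f g : L2 d E) :
    inner ℂ (tfShift (z + w) f) g
      = char (-inner ℝ w.2 z.1 - inner ℝ z.2 z.1) * inner ℂ (tfShift w f) (tfShift (-z) g) := by
  have h : tfShift (z + w) f = char (inner ℝ w.2 z.1) • tfShift z (tfShift w f) := by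
    rw [tfShift_tfShift, smul_smul, ← char_add, add_neg_cancel, char_zero, one_smul]
  rw [h, inner_smul_left, inner_tfShift_left, ← char_neg, ← mul_assoc, ← char_add]
  rfl

end Inner

theorem exists_norm_eq_one (d : ℕ) : ∃ φ : L2 d ℂ, ‖φ‖ = 1 := by
  have hB : volume (Metric.ball (0 : EuclideanSpace ℝ (Fin d)) 1) ≠ ⊤ := measure_ball_lt_top.ne
  have hB0 : volume (Metric.ball (0 : EuclideanSpace ℝ (Fin d)) 1) ≠ 0 :=
    (Metric.measure_ball_pos _ _ one_pos).ne'
  let f : L2 d ℂ := indicatorConstLp 2 measurableSet_ball hB 1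
  have hf : ‖f‖ ≠ 0 := by
    rw [norm_indicatorConstLp (by simp) (by simp)]
    simp only [norm_one, one_mul]
    exact (Real.rpow_pos_of_pos (ENNReal.toReal_pos hB0 hB) _).ne'
  exact ⟨((‖f‖⁻¹ : ℝ) : ℂ) • f, by simp [norm_smul, hf]⟩

/-- The commutator of two shifts is the scalar `char (sympl l w)`, so testing on a single nonzero
vector decides whether they commute. -/
theorem mem_adjointLattice_iff {d : ℕ} {S : Set (PhaseSpace d)} {w : PhaseSpace d} :
    w ∈ adjointLattice S ↔ ∀ l ∈ S, ∃ k : ℤ, sympl l w = k := by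
  refine forall₂_congr fun l _ => ?_
  rw [← char_eq_one_iff]
  constructor
  · intro h
    obtain ⟨φ, hφ⟩ := exists_norm_eq_one d
    have h0 : tfShift w (tfShift l φ) ≠ 0 := by
      rw [← norm_ne_zero_iff, norm_tfShift, norm_tfShift, hφ]; exact one_ne_zero
    have h1 := h φ
    rw [tfShift_comm] at h1
    have h2 : (char (sympl l w) - 1) • tfShift w (tfShift l φ) = 0 := by
      rw [sub_smul, h1, one_smul, sub_self]
    rcases smul_eq_zero.1 h2 with h3 | h3
    · exact sub_eq_zero.1 h3
    · exact absurd h3 h0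
  · intro h f
    rw [tfShift_comm, h, one_smul]

/-! ### Strong continuity of the shifts -/

section Continuity

variable {d : ℕ} {E : Type} [NormedAddCommGroup E] [InnerProductSpace ℂ E]

theorem tfShift_sub (z : PhaseSpace d) (f g : L2 d E) :
    tfShift z (f - g) = tfShift z f - tfShift z g :=
  map_sub (tfIsom z) f g

theorem continuous_translation (f : L2 d E) :
    Continuous fun x : EuclideanSpace ℝ (Fin d) => tfShift ((x, 0) : PhaseSpace d) f := by
  have h : ∀ x : EuclideanSpace ℝ (Fin d), tfShift ((x, 0) : PhaseSpace d) f
      = DomAddAct.mk (-x) +ᵥ f := by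
    intro x
    apply Lp.ext
    filter_upwards [coeFn_tfShift' ((x, 0) : PhaseSpace d) f,
      DomAddAct.vadd_Lp_ae_eq (DomAddAct.mk (-x)) f] with t h1 h2
    rw [h1, h2]
    simp [sub_eq_neg_add]
  simp_rw [h]
  have hx : Continuous fun x : EuclideanSpace ℝ (Fin d) => DomAddAct.mk (-x) :=
    DomAddAct.continuous_mk.comp continuous_neg
  have : Fact ((2 : ℝ≥0∞) ≠ ∞) := ⟨by simp⟩
  exact hx.vadd continuous_const

theorem continuous_inner_modulation (f g : L2 d E) :
    Continuous fun ξ : EuclideanSpace ℝ (Fin d) =>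
      inner ℂ (tfShift ((0, ξ) : PhaseSpace d) f) g := by
  have h : ∀ ξ : EuclideanSpace ℝ (Fin d), inner ℂ (tfShift ((0, ξ) : PhaseSpace d) f) g
      = ∫ t, conj (char (inner ℝ ξ t)) * inner ℂ (f t) (g t) := by
    intro ξ
    rw [L2.inner_def]
    refine integral_congr_ae ?_
    filter_upwards [coeFn_tfShift' ((0, ξ) : PhaseSpace d) f] with t h1
    rw [h1, inner_smul_left, sub_zero]
  simp_rw [h]
  refine continuous_of_dominated (bound := fun t => ‖inner ℂ (f t) (g t)‖) (fun ξ => ?_)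
    (fun ξ => ?_) (L2.integrable_inner f g).norm ?_
  · exact (Continuous.aestronglyMeasurable (by fun_prop)).mul (L2.integrable_inner f g).1
  · refine Filter.Eventually.of_forall fun t => ?_
    rw [norm_mul, RCLike.norm_conj, norm_char, one_mul]
  · refine Filter.Eventually.of_forall fun t => ?_
    exact (Complex.continuous_conj.comp (by fun_prop)).mul continuous_const

/-- Modulations preserve the norm, so weak continuity upgrades to norm continuity by expanding `‖x -
y‖²`. -/
theorem continuous_modulation (f : L2 d E) :
    Continuous fun ξ : EuclideanSpace ℝ (Fin d) => tfShift ((0, ξ) : PhaseSpace d) f := by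
  rw [continuous_iff_continuousAt]
  intro η
  rw [ContinuousAt, tendsto_iff_norm_sub_tendsto_zero]
  have h1 : ∀ ξ : EuclideanSpace ℝ (Fin d),
      ‖tfShift ((0, ξ) : PhaseSpace d) f - tfShift ((0, η) : PhaseSpace d) f‖
        = √(2 * ‖f‖ ^ 2 - 2 * (inner ℂ (tfShift ((0, ξ) : PhaseSpace d) f)
          (tfShift ((0, η) : PhaseSpace d) f)).re) := by
    intro ξ
    rw [← Real.sqrt_sq (norm_nonneg (tfShift ((0, ξ) : PhaseSpace d) f - _)),
      @norm_sub_sq ℂ, norm_tfShift, norm_tfShift, RCLike.re_eq_complex_re]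
    congr 1
    ring
  simp_rw [h1]
  have h2 := ((continuous_inner_modulation f (tfShift ((0, η) : PhaseSpace d) f)).tendsto η)
  have h3 : Filter.Tendsto (fun ξ : EuclideanSpace ℝ (Fin d) =>
      √(2 * ‖f‖ ^ 2 - 2 * (inner ℂ (tfShift ((0, ξ) : PhaseSpace d) f)
          (tfShift ((0, η) : PhaseSpace d) f)).re)) (nhds η)
      (nhds √(2 * ‖f‖ ^ 2 - 2 * (inner ℂ (tfShift ((0, η) : PhaseSpace d) f)
          (tfShift ((0, η) : PhaseSpace d) f)).re)) := by
    exact (Real.continuous_sqrt.tendsto _).comp (tendsto_const_nhds.sub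
      (tendsto_const_nhds.mul ((Complex.continuous_re.tendsto _).comp h2)))
  convert h3 using 2
  rw [inner_tfShift_tfShift, ← RCLike.re_eq_complex_re, inner_self_eq_norm_sq, sub_self,
    Real.sqrt_zero]

theorem continuous_tfShift (f : L2 d E) : Continuous fun z : PhaseSpace d => tfShift z f := by
  have h : ∀ z : PhaseSpace d, tfShift z f
      = tfShift ((0, z.2) : PhaseSpace d) (tfShift ((z.1, 0) : PhaseSpace d) f) := by
    intro z
    have hz : ((0, z.2) + (z.1, 0) : PhaseSpace d) = z :=
      Prod.ext (zero_add _) (add_zero _)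
    rw [tfShift_tfShift, hz, inner_zero_left, neg_zero, char_zero, one_smul]
  refine Continuous.congr ?_ fun z => (h z).symm
  rw [continuous_iff_continuousAt]
  intro w
  rw [ContinuousAt, tendsto_iff_norm_sub_tendsto_zero]
  have hT : Filter.Tendsto (fun z : PhaseSpace d =>
      ‖tfShift ((z.1, 0) : PhaseSpace d) f - tfShift ((w.1, 0) : PhaseSpace d) f‖)
      (nhds w) (nhds 0) :=
    tendsto_iff_norm_sub_tendsto_zero.1
      (((continuous_translation f).comp continuous_fst).tendsto w)
  have hM : Filter.Tendsto (fun z : PhaseSpace d =>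
      ‖tfShift ((0, z.2) : PhaseSpace d) (tfShift ((w.1, 0) : PhaseSpace d) f)
        - tfShift ((0, w.2) : PhaseSpace d) (tfShift ((w.1, 0) : PhaseSpace d) f)‖)
      (nhds w) (nhds 0) :=
    tendsto_iff_norm_sub_tendsto_zero.1
      (((continuous_modulation (tfShift ((w.1, 0) : PhaseSpace d) f)).comp
        continuous_snd).tendsto w)
  -- The intermediate vector changes only the translation, and the modulation in front of that
  -- difference is an isometry. The other difference changes only the modulation of a fixed vector.
  refine squeeze_zero (fun _ => norm_nonneg _) (fun z => ?_) (by simpa using hT.add hM)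
  refine (norm_sub_le_norm_sub_add_norm_sub _
    (tfShift ((0, z.2) : PhaseSpace d) (tfShift ((w.1, 0) : PhaseSpace d) f)) _).trans ?_
  gcongr
  rw [← tfShift_sub, norm_tfShift]

end Continuity

/-! ### Plancherel for Fourier integrals -/

section Plancherel

variable {V : Type*} [NormedAddCommGroup V] [InnerProductSpace ℝ V] [FiniteDimensional ℝ V]
  [MeasurableSpace V] [BorelSpace V]

/-- On `L¹ ∩ L²` the `L²` Fourier transform is given by the Fourier integral. -/
theorem fourier_toLp_ae_eq {h : V → ℂ} (h1 : Integrable h) (h2 : MemLp h 2) :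
    (𝓕 (h2.toLp h) : Lp ℂ 2 (volume : Measure V)) =ᵐ[volume] 𝓕 h := by
  have hcont : Continuous (𝓕 h) :=
    VectorFourier.fourierIntegral_continuous Real.continuous_fourierChar continuous_inner h1
  -- Both sides are compared against smooth compactly supported functions. The `L²` transform is
  -- handled as a tempered distribution, the integral by the multiplication formula `∫ ĥ G = ∫ h Ĝ`.
  refine ae_eq_of_integral_contDiff_smul_eq
    ((Lp.memLp (𝓕 (h2.toLp h) : Lp ℂ 2 (volume : Measure V))).locallyIntegrable one_le_two)
    hcont.locallyIntegrable fun g hg hgc => ?_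
  have hg' : ContDiff ℝ (⊤ : ℕ∞) (fun x => (g x : ℂ)) := Complex.ofRealCLM.contDiff.comp hg
  have hgc' : HasCompactSupport (fun x => (g x : ℂ)) := hgc.comp_left Complex.ofReal_zero
  let G : SchwartzMap V ℂ := hgc'.toSchwartzMap hg'
  have e1 : ∫ x, g x • (𝓕 (h2.toLp h) : Lp ℂ 2 (volume : Measure V)) x
      = Lp.toTemperedDistribution (𝓕 (h2.toLp h) : Lp ℂ 2 (volume : Measure V)) G := by
    rw [Lp.toTemperedDistribution_apply]
    rfl
  rw [e1, ← Lp.fourier_toTemperedDistribution_eq, TemperedDistribution.fourier_apply,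
    Lp.toTemperedDistribution_apply]
  have e2 : ∫ x, g x • 𝓕 h x = ∫ x, 𝓕 h x • G x := by
    refine integral_congr_ae (Filter.Eventually.of_forall fun x => ?_)
    change ((g x : ℝ) • 𝓕 h x : ℂ) = 𝓕 h x * (g x : ℂ)
    rw [Complex.real_smul, mul_comm]
  have e3 := VectorFourier.integral_fourierIntegral_smul_eq_flip (L := innerₗ V) (μ := volume)
    (ν := volume) Real.continuous_fourierChar continuous_inner h1 G.integrable
  rw [e2]
  refine Eq.trans ?_ e3.symm
  refine integral_congr_ae ?_
  filter_upwards [h2.coeFn_toLp] with x hx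
  rw [hx, smul_eq_mul, smul_eq_mul, mul_comm]
  congr 1
  rw [flip_innerₗ]
  rfl

theorem lintegral_fourier_sq {h : V → ℂ} (h1 : Integrable h) (h2 : MemLp h 2) :
    ∫⁻ ξ, ‖𝓕 h ξ‖ₑ ^ 2 = ∫⁻ t, ‖h t‖ₑ ^ 2 := by
  have e := Lp.norm_fourier_eq (h2.toLp h)
  rw [Lp.norm_def, Lp.norm_def, ENNReal.toReal_eq_toReal_iff' (Lp.eLpNorm_ne_top _)
    (Lp.eLpNorm_ne_top _), eLpNorm_congr_ae (fourier_toLp_ae_eq h1 h2),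
    eLpNorm_congr_ae h2.coeFn_toLp] at e
  rw [eLpNorm_eq_lintegral_rpow_enorm_toReal (by simp) (by simp),
    eLpNorm_eq_lintegral_rpow_enorm_toReal (by simp) (by simp)] at e
  simpa using ENNReal.rpow_left_injective (by simp) e

theorem integral_fourier_mul_conj {h k : V → ℂ} (h1 : Integrable h) (h2 : MemLp h 2)
    (k1 : Integrable k) (k2 : MemLp k 2) :
    ∫ ξ, 𝓕 h ξ * conj (𝓕 k ξ) = ∫ t, h t * conj (k t) := by
  have e := Lp.inner_fourier_eq (k2.toLp k) (h2.toLp h)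
  rw [L2.inner_def, L2.inner_def] at e
  refine Eq.trans ?_ (e.trans ?_)
  · refine integral_congr_ae ?_
    filter_upwards [fourier_toLp_ae_eq h1 h2, fourier_toLp_ae_eq k1 k2] with x hx kx
    rw [hx, kx, RCLike.inner_apply]
  · refine integral_congr_ae ?_
    filter_upwards [h2.coeFn_toLp, k2.coeFn_toLp] with x hx kx
    rw [hx, kx, RCLike.inner_apply]

end Plancherel

/-! ### Orthogonality relations of the short-time Fourier transform -/

section Moyal

variable {d : ℕ}

/-- The slice `t ↦ f(t) · conj φ(t - x)` whose Fourier transform is the short-time Fourier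
transform. -/
def slice (φ f : L2 d ℂ) (x t : EuclideanSpace ℝ (Fin d)) : ℂ := f t * conj (φ (t - x))

theorem measurable_slice (φ f : L2 d ℂ) : Measurable (Function.uncurry (slice φ f)) := by
  have hf := (Lp.stronglyMeasurable f).measurable
  have hφ := (Lp.stronglyMeasurable φ).measurable
  unfold Function.uncurry slice
  exact (hf.comp measurable_snd).mul
    (Complex.continuous_conj.measurable.comp (hφ.comp (measurable_snd.sub measurable_fst)))

theorem inner_tfShift_eq_fourier (φ f : L2 d ℂ) (x ξ : EuclideanSpace ℝ (Fin d)) :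
    inner ℂ (tfShift ((x, ξ) : PhaseSpace d) φ) f = 𝓕 (slice φ f x) ξ := by
  rw [L2.inner_def, Real.fourier_eq]
  refine integral_congr_ae ?_
  filter_upwards [coeFn_tfShift' ((x, ξ) : PhaseSpace d) φ] with t h1
  rw [h1, RCLike.inner_apply, slice, Circle.smul_def, ← char_eq_fourierChar, smul_eq_mul,
    smul_eq_mul, map_mul, char_neg, real_inner_comm]
  ring

theorem lintegral_enorm_sq (f : L2 d ℂ) : ∫⁻ t, ‖f t‖ₑ ^ 2 = ‖f‖ₑ ^ 2 := by
  rw [Lp.enorm_def, eLpNorm_eq_lintegral_rpow_enorm_toReal (by simp) (by simp)]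
  simp only [ENNReal.toReal_ofNat, ENNReal.rpow_ofNat]
  rw [← ENNReal.rpow_natCast, ← ENNReal.rpow_mul]
  simp

theorem lintegral_slice (φ f : L2 d ℂ) :
    ∫⁻ x, ∫⁻ t, ‖slice φ f x t‖ₑ ^ 2 = ‖φ‖ₑ ^ 2 * ‖f‖ₑ ^ 2 := by
  rw [lintegral_lintegral_swap ((measurable_slice φ f).enorm.pow_const 2).aemeasurable]
  have h : ∀ t, ∫⁻ x, ‖slice φ f x t‖ₑ ^ 2 = ‖f t‖ₑ ^ 2 * ‖φ‖ₑ ^ 2 := by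
    intro t
    simp only [slice, enorm_mul, mul_pow, RCLike.enorm_conj]
    have hm : Measurable fun x => ‖φ (t - x)‖ₑ ^ 2 :=
      ((Lp.stronglyMeasurable φ).measurable.comp
        (measurable_const.sub measurable_id)).enorm.pow_const 2
    rw [lintegral_const_mul _ hm, ← lintegral_enorm_sq φ,
      lintegral_sub_left_eq_self (fun x => ‖φ x‖ₑ ^ 2) t]
  simp_rw [h]
  rw [lintegral_mul_const _ ((Lp.stronglyMeasurable f).measurable.enorm.pow_const 2),
    lintegral_enorm_sq, mul_comm]

theorem integrable_slice (φ f : L2 d ℂ) (x : EuclideanSpace ℝ (Fin d)) :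
    Integrable (slice φ f x) := by
  have h2 : MemLp (fun t => conj (φ (t - x))) 2 volume :=
    ((Lp.memLp φ).comp_measurePreserving (measurePreserving_sub_right volume x)).star
  exact MemLp.integrable_mul (Lp.memLp f) h2

/-- Each slice is integrable, but only almost every one is square integrable: this comes from
finiteness of the double integral. -/
theorem memLp_slice (φ f : L2 d ℂ) : ∀ᵐ x, MemLp (slice φ f x) 2 := by
  have hm : Measurable fun x => ∫⁻ t, ‖slice φ f x t‖ₑ ^ 2 :=
    ((measurable_slice φ f).enorm.pow_const 2).lintegral_prod_right'
  have hfin : ∫⁻ x, ∫⁻ t, ‖slice φ f x t‖ₑ ^ 2 ≠ ⊤ := by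
    rw [lintegral_slice]; simp [ENNReal.mul_eq_top]
  filter_upwards [ae_lt_top hm hfin] with x hx
  refine ⟨(integrable_slice φ f x).1, ?_⟩
  rw [eLpNorm_lt_top_iff_lintegral_rpow_enorm_lt_top (by simp) (by simp)]
  simpa using hx

theorem continuous_inner_tfShift (φ f : L2 d ℂ) :
    Continuous fun z : PhaseSpace d => inner ℂ (tfShift z φ) f :=
  (continuous_tfShift φ).inner continuous_const

/-- The short-time Fourier transform is an isometry. -/
theorem lintegral_inner_tfShift_sq (φ f : L2 d ℂ) :
    ∫⁻ z : PhaseSpace d, ‖(inner ℂ (tfShift z φ) f : ℂ)‖ₑ ^ 2 = ‖φ‖ₑ ^ 2 * ‖f‖ₑ ^ 2 := by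
  rw [Measure.volume_eq_prod, lintegral_prod _
    ((continuous_inner_tfShift φ f).measurable.enorm.pow_const 2).aemeasurable, ← lintegral_slice]
  refine lintegral_congr_ae ?_
  filter_upwards [memLp_slice φ f] with x hx
  simp_rw [inner_tfShift_eq_fourier]
  exact lintegral_fourier_sq (integrable_slice φ f x) hx

theorem memLp_inner_tfShift (φ f : L2 d ℂ) :
    MemLp (fun z : PhaseSpace d => (inner ℂ (tfShift z φ) f : ℂ)) 2 := by
  refine ⟨(continuous_inner_tfShift φ f).aestronglyMeasurable, ?_⟩
  rw [eLpNorm_lt_top_iff_lintegral_rpow_enorm_lt_top (by simp) (by simp)]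
  have := lintegral_inner_tfShift_sq φ f
  simp only [ENNReal.toReal_ofNat, ENNReal.rpow_ofNat]
  rw [this]
  exact ENNReal.mul_lt_top (by simp) (by simp)

theorem integrable_inner_mul_conj (φ ψ f g : L2 d ℂ) :
    Integrable fun z : PhaseSpace d =>
      inner ℂ (tfShift z φ) f * conj (inner ℂ (tfShift z ψ) g) :=
  MemLp.integrable_mul (memLp_inner_tfShift φ f) (memLp_inner_tfShift ψ g).star

theorem integrable_slice_mul_conj (φ ψ f g : L2 d ℂ) :
    Integrable (Function.uncurry fun x t => slice φ f x t * conj (slice ψ g x t))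
      (volume.prod volume) := by
  have h : ∀ φ f : L2 d ℂ, MemLp (Function.uncurry (slice φ f)) 2 (volume.prod volume) := by
    intro φ f
    refine ⟨(measurable_slice φ f).aestronglyMeasurable, ?_⟩
    rw [eLpNorm_lt_top_iff_lintegral_rpow_enorm_lt_top (by simp) (by simp)]
    simp only [ENNReal.toReal_ofNat, ENNReal.rpow_ofNat]
    rw [lintegral_prod _ ((measurable_slice φ f).enorm.pow_const 2).aemeasurable]
    refine (lintegral_slice φ f).trans_lt ?_
    exact ENNReal.mul_lt_top (by simp) (by simp)
  exact MemLp.integrable_mul (h φ f) (h ψ g).star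

/-- The orthogonality relations of the short-time Fourier transform. -/
theorem integral_inner_mul_conj (φ ψ f g : L2 d ℂ) :
    ∫ z : PhaseSpace d, inner ℂ (tfShift z φ) f * conj (inner ℂ (tfShift z ψ) g)
      = inner ℂ g f * inner ℂ φ ψ := by
  rw [Measure.volume_eq_prod, integral_prod _ (integrable_inner_mul_conj φ ψ f g)]
  have h1 : ∀ᵐ x : EuclideanSpace ℝ (Fin d), ∫ ξ : EuclideanSpace ℝ (Fin d),
      inner ℂ (tfShift ((x, ξ) : PhaseSpace d) φ) f
        * conj (inner ℂ (tfShift ((x, ξ) : PhaseSpace d) ψ) g)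
      = ∫ t, slice φ f x t * conj (slice ψ g x t) := by
    filter_upwards [memLp_slice φ f, memLp_slice ψ g] with x h1 h2
    simp_rw [inner_tfShift_eq_fourier]
    exact integral_fourier_mul_conj (integrable_slice φ f x) h1 (integrable_slice ψ g x) h2
  rw [integral_congr_ae h1, integral_integral_swap (integrable_slice_mul_conj φ ψ f g)]
  have h2 : ∀ t, ∫ x, slice φ f x t * conj (slice ψ g x t)
      = inner ℂ (g t) (f t) * inner ℂ φ ψ := by
    intro t
    rw [L2.inner_def, ← integral_sub_left_eq_self (fun x => inner ℂ (φ x) (ψ x)) volume t,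
      ← integral_const_mul]
    refine integral_congr_ae (Filter.Eventually.of_forall fun x => ?_)
    simp only [slice, RCLike.inner_apply, map_mul, RCLike.conj_conj]
    ring
  simp_rw [h2]
  rw [integral_mul_const, ← L2.inner_def]

end Moyal

theorem enorm_char (r : ℝ) : ‖char r‖ₑ = 1 := by
  rw [← ofReal_norm, norm_char, ENNReal.ofReal_one]

section Adjoint

variable {d : ℕ} {E : Type} [NormedAddCommGroup E] [InnerProductSpace ℂ E]

/-- The adjoint of the time-frequency shift `π_z`. -/
def tfAdj (z : PhaseSpace d) (f : L2 d E) : L2 d E :=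
  char (-inner ℝ z.2 z.1) • tfShift (-z) f

theorem inner_tfShift_eq_inner_tfAdj (z : PhaseSpace d) (f g : L2 d E) :
    inner ℂ (tfShift z f) g = inner ℂ f (tfAdj z g) := by
  rw [inner_tfShift_left, tfAdj, inner_smul_right]

theorem tfAdj_tfShift (w z : PhaseSpace d) (f : L2 d E) :
    tfAdj w (tfShift z f) = char (sympl z w) • tfShift z (tfAdj w f) := by
  rw [tfAdj, tfAdj, tfShift_comm, tfShift_smul, smul_comm]
  congr 2
  simp only [sympl, Prod.fst_neg, Prod.snd_neg, inner_neg_left, inner_neg_right]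
  ring

theorem norm_tfAdj (z : PhaseSpace d) (f : L2 d E) : ‖tfAdj z f‖ = ‖f‖ := by
  rw [tfAdj, norm_smul, norm_char, one_mul, norm_tfShift]

end Adjoint

/-! ### Averaging over a fundamental domain -/

section Lattice

instance instIsAddHaarMeasureVolume {d : ℕ} :
    (volume : Measure (PhaseSpace d)).IsAddHaarMeasure :=
  inferInstanceAs ((volume : Measure (EuclideanSpace ℝ (Fin d))).prod
    (volume : Measure (EuclideanSpace ℝ (Fin d)))).IsAddHaarMeasure

instance instVAddInvariantMeasureSubmodule {d : ℕ} (L : Submodule ℤ (PhaseSpace d)) :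
    VAddInvariantMeasure L (PhaseSpace d) volume :=
  inferInstanceAs (VAddInvariantMeasure L.toAddSubgroup (PhaseSpace d) volume)

variable {d : ℕ} {ι : Type*} [Finite ι] (b : Module.Basis ι ℝ (PhaseSpace d))

/-- The points `w` with `ω(l, w) ∈ ℤ` for all `l ∈ S`. -/
def symplDual (S : Set (PhaseSpace d)) : Set (PhaseSpace d) :=
  {w | ∀ l ∈ S, ∃ k : ℤ, sympl l w = k}

theorem sub_mem_symplDual {S : Set (PhaseSpace d)} {w v : PhaseSpace d} (hw : w ∈ symplDual S)
    (hv : v ∈ symplDual S) : w - v ∈ symplDual S := by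
  intro l hl
  obtain ⟨k, hk⟩ := hw l hl
  obtain ⟨m, hm⟩ := hv l hl
  refine ⟨k - m, ?_⟩
  have : sympl l (w - v) = sympl l w - sympl l v := by
    simp only [sympl, Prod.fst_sub, Prod.snd_sub, inner_sub_left, inner_sub_right]; ring
  rw [this, hk, hm]; push_cast; ring

theorem exists_char_sympl_ne_one {w : PhaseSpace d} (hw : w ≠ 0) :
    ∃ v : PhaseSpace d, char (sympl v w) ≠ 1 := by
  let v : PhaseSpace d := (-w.2, w.1)
  have hv : sympl v w = ‖w.1‖ ^ 2 + ‖w.2‖ ^ 2 := by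
    simp only [sympl, v, inner_neg_right, real_inner_self_eq_norm_sq]; ring
  have hpos : 0 < sympl v w := by
    rw [hv]
    by_contra h
    have h1 : ‖w.1‖ = 0 := by nlinarith [sq_nonneg ‖w.1‖, sq_nonneg ‖w.2‖]
    have h2 : ‖w.2‖ = 0 := by nlinarith [sq_nonneg ‖w.1‖, sq_nonneg ‖w.2‖]
    exact hw (Prod.ext (norm_eq_zero.1 h1) (norm_eq_zero.1 h2))
  -- This scaling makes the pairing equal to `1/2`, which is not an integer.
  refine ⟨(2 * sympl v w)⁻¹ • v, ?_⟩
  rw [Ne, char_eq_one_iff, sympl_smul_left]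
  rintro ⟨k, hk⟩
  have h2 : (2 : ℝ) * k = 1 := by
    rw [← hk]; field_simp
  have h3 : 2 * k = 1 := by exact_mod_cast h2
  omega

/-- A translate of a fundamental domain is again one, and periodic functions have the same integral
over both. -/
theorem setIntegral_fundamentalDomain_add (v : PhaseSpace d) {F : PhaseSpace d → ℂ}
    (hF : ∀ l ∈ Submodule.span ℤ (Set.range b), ∀ z, F (l + z) = F z) :
    ∫ z in ZSpan.fundamentalDomain b, F (v + z) = ∫ z in ZSpan.fundamentalDomain b, F z := by
  have h1 := ZSpan.isAddFundamentalDomain b (volume : Measure (PhaseSpace d))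
  have h2 := h1.vadd_of_comm v
  rw [h1.setIntegral_eq h2 (f := F) fun l z => hF l l.2 z]
  exact ((measurePreserving_vadd v volume).setIntegral_image_emb
    (measurableEmbedding_const_vadd v) F _).symm

theorem volume_fundamentalDomain_lt_top : volume (ZSpan.fundamentalDomain b) < ⊤ :=
  (ZSpan.fundamentalDomain_isBounded b).measure_lt_top

theorem volume_fundamentalDomain_ne_zero : volume (ZSpan.fundamentalDomain b) ≠ 0 :=
  ZSpan.measure_fundamentalDomain_ne_zero b

/-- Translating by `v` leaves the integral unchanged yet multiplies it by `char (sympl v w)`, which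
differs from `1` for a suitable `v`. -/
theorem setIntegral_char_sympl {w : PhaseSpace d}
    (hw : w ∈ symplDual (Submodule.span ℤ (Set.range b) : Set (PhaseSpace d))) (h0 : w ≠ 0) :
    ∫ z in ZSpan.fundamentalDomain b, char (sympl z w) = 0 := by
  obtain ⟨v, hv⟩ := exists_char_sympl_ne_one h0
  have h := setIntegral_fundamentalDomain_add b v (F := fun z => char (sympl z w)) (by
    intro l hl z
    beta_reduce
    rw [sympl_add_left, char_add, (char_eq_one_iff _).2 (hw l hl), one_mul])
  simp only [sympl_add_left, char_add] at h
  rw [integral_const_mul] at h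
  have h3 : (char (sympl v w) - 1) * ∫ z in ZSpan.fundamentalDomain b, char (sympl z w) = 0 := by
    rw [sub_mul, h]; ring
  exact (mul_eq_zero.1 h3).resolve_left (sub_ne_zero.2 hv)

theorem integrableOn_of_continuous {F : Type*} [NormedAddCommGroup F] {f : PhaseSpace d → F}
    (hf : Continuous f) : IntegrableOn f (ZSpan.fundamentalDomain b) :=
  (hf.continuousOn.integrableOn_compact
    (ZSpan.fundamentalDomain_isBounded b).isCompact_closure).mono_set subset_closure

/-- Averaging over a fundamental domain makes the vectors `π_w^* π_z φ` orthogonal. -/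
theorem setIntegral_inner_tfAdj {w v : PhaseSpace d}
    (hw : w ∈ symplDual (Submodule.span ℤ (Set.range b) : Set (PhaseSpace d)))
    (hv : v ∈ symplDual (Submodule.span ℤ (Set.range b) : Set (PhaseSpace d))) (hwv : w ≠ v)
    (φ : L2 d ℂ) :
    ∫ z in ZSpan.fundamentalDomain b,
      inner ℂ (tfAdj w (tfShift z φ)) (tfAdj v (tfShift z φ)) = 0 := by
  have h : ∀ z, inner ℂ (tfAdj w (tfShift z φ)) (tfAdj v (tfShift z φ))
      = char (sympl z (v - w)) * inner ℂ (tfAdj w φ) (tfAdj v φ) := by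
    intro z
    rw [tfAdj_tfShift, tfAdj_tfShift, inner_smul_left, inner_smul_right, inner_tfShift_tfShift,
      ← mul_assoc, ← char_neg, ← char_add]
    congr 2
    simp only [sympl, Prod.fst_sub, Prod.snd_sub, inner_sub_left, inner_sub_right]; ring
  simp_rw [h]
  rw [integral_mul_const, setIntegral_char_sympl b (sub_mem_symplDual hv hw)
    (sub_ne_zero.2 hwv.symm), zero_mul]

theorem continuous_tfAdj_tfShift (w : PhaseSpace d) (φ : L2 d ℂ) :
    Continuous fun z : PhaseSpace d => tfAdj w (tfShift z φ) :=
  (continuous_const_smul _).comp ((tfIsom (-w)).continuous.comp (continuous_tfShift φ))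

/-- Pythagoras after averaging: on expanding the square, the off-diagonal terms integrate to zero,
and each diagonal term is constant because the shifted windows are unit vectors. -/
theorem setLIntegral_enorm_sum_tfAdj {J : Type*} (s : Finset J) (w : J → PhaseSpace d)
    (hw : ∀ i ∈ s, w i ∈ symplDual (Submodule.span ℤ (Set.range b) : Set (PhaseSpace d)))
    (hinj : Set.InjOn w s) (c : J → ℂ) {φ : L2 d ℂ} (hφ : ‖φ‖ = 1) :
    ∫⁻ z in ZSpan.fundamentalDomain b, ‖∑ i ∈ s, c i • tfAdj (w i) (tfShift z φ)‖ₑ ^ 2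
      = volume (ZSpan.fundamentalDomain b) * ∑ i ∈ s, ‖c i‖ₑ ^ 2 := by
  have hc : Continuous fun z : PhaseSpace d => ∑ i ∈ s, c i • tfAdj (w i) (tfShift z φ) :=
    continuous_finsetSum _ fun i _ =>
      (continuous_const_smul _).comp (continuous_tfAdj_tfShift (w i) φ)
  have e1 : ∫ z in ZSpan.fundamentalDomain b, ‖∑ i ∈ s, c i • tfAdj (w i) (tfShift z φ)‖ ^ 2
      = volume.real (ZSpan.fundamentalDomain b) * ∑ i ∈ s, ‖c i‖ ^ 2 := by
    apply Complex.ofReal_injective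
    rw [← integral_complex_ofReal]
    have h : ∀ z : PhaseSpace d, ((‖∑ i ∈ s, c i • tfAdj (w i) (tfShift z φ)‖ ^ 2 : ℝ) : ℂ)
        = ∑ i ∈ s, ∑ k ∈ s, conj (c i) * c k *
          inner ℂ (tfAdj (w i) (tfShift z φ)) (tfAdj (w k) (tfShift z φ)) := by
      intro z
      rw [Complex.ofReal_pow]
      refine (inner_self_eq_norm_sq_to_K (𝕜 := ℂ)
        (∑ i ∈ s, c i • tfAdj (w i) (tfShift z φ))).symm.trans ?_
      rw [sum_inner]
      refine Finset.sum_congr rfl fun i _ => ?_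
      rw [inner_sum]
      refine Finset.sum_congr rfl fun k _ => ?_
      rw [inner_smul_left, inner_smul_right, mul_assoc]
    simp_rw [h]
    have hint : ∀ i k, Integrable (fun z => conj (c i) * c k *
        inner ℂ (tfAdj (w i) (tfShift z φ)) (tfAdj (w k) (tfShift z φ)))
        (volume.restrict (ZSpan.fundamentalDomain b)) := fun i k =>
      integrableOn_of_continuous b (continuous_const.mul
        ((continuous_tfAdj_tfShift (w i) φ).inner (continuous_tfAdj_tfShift (w k) φ)))
    rw [integral_finsetSum _ fun i _ => integrable_finsetSum _ fun k _ => hint i k]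
    push_cast
    rw [Finset.mul_sum]
    refine Finset.sum_congr rfl fun i hi => ?_
    rw [integral_finsetSum _ fun k _ => hint i k, Finset.sum_eq_single_of_mem i hi]
    · rw [integral_const_mul]
      have h1 : ∀ z : PhaseSpace d,
          inner ℂ (tfAdj (w i) (tfShift z φ)) (tfAdj (w i) (tfShift z φ)) = (1 : ℂ) := by
        intro z
        rw [inner_self_eq_norm_sq_to_K, norm_tfAdj, norm_tfShift, hφ]; simp
      simp_rw [h1]
      rw [setIntegral_const, Complex.conj_mul', Complex.real_smul]
      ring
    · intro k hk hki
      rw [integral_const_mul, setIntegral_inner_tfAdj b (hw i hi) (hw k hk)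
        (fun h => hki (hinj hk hi h.symm)), mul_zero]
  have e2 := ofReal_integral_eq_lintegral_ofReal
    (integrableOn_of_continuous b (hc.norm.pow 2)) (Filter.Eventually.of_forall fun z => by
      simp only [Pi.zero_apply, Pi.pow_apply]; positivity)
  have e3 : ∀ z : PhaseSpace d, ‖∑ i ∈ s, c i • tfAdj (w i) (tfShift z φ)‖ₑ ^ 2
      = ENNReal.ofReal (‖∑ i ∈ s, c i • tfAdj (w i) (tfShift z φ)‖ ^ 2) := by
    intro z
    rw [ENNReal.ofReal_pow (norm_nonneg _), ofReal_norm]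
  simp_rw [e3]
  refine e2.symm.trans ?_
  have e4 : ∀ i, ‖c i‖ₑ ^ 2 = ENNReal.ofReal (‖c i‖ ^ 2) := by
    intro i
    rw [ENNReal.ofReal_pow (norm_nonneg _), ofReal_norm]
  simp_rw [e4]
  rw [← ENNReal.ofReal_sum_of_nonneg (fun i _ => by positivity),
    ← ENNReal.ofReal_toReal (volume_fundamentalDomain_lt_top b).ne,
    ← ENNReal.ofReal_mul ENNReal.toReal_nonneg]
  exact congrArg _ e1

variable {κ : Type*} [Fintype κ] [DecidableEq κ]

/-- The vector with components `∑_{i ∈ s, j i = k} c̄ᵢ π_{wᵢ}^* π_z φ`. -/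
def testVector {J : Type*} (s : Finset J) (j : J → κ) (w : J → PhaseSpace d) (c : J → ℂ)
    (φ : L2 d ℂ) (z : PhaseSpace d) (k : κ) : L2 d ℂ :=
  ∑ i ∈ s with j i = k, conj (c i) • tfAdj (w i) (tfShift z φ)

/-- Different values of `j` contribute to different components, so distinct shifts are needed only
within one fibre of `j`. -/
theorem setLIntegral_testVector {J : Type*} (s : Finset J) (j : J → κ) (w : J → PhaseSpace d)
    (hw : ∀ i ∈ s, w i ∈ symplDual (Submodule.span ℤ (Set.range b) : Set (PhaseSpace d)))
    (hinj : Set.InjOn (fun i => (j i, w i)) s) (c : J → ℂ) {φ : L2 d ℂ} (hφ : ‖φ‖ = 1) :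
    ∫⁻ z in ZSpan.fundamentalDomain b, ∑ k, ‖testVector s j w c φ z k‖ₑ ^ 2
      = volume (ZSpan.fundamentalDomain b) * ∑ i ∈ s, ‖c i‖ₑ ^ 2 := by
  have hc : ∀ k, Continuous fun z : PhaseSpace d => testVector s j w c φ z k := fun k =>
    continuous_finsetSum _ fun i _ =>
      (continuous_const_smul _).comp (continuous_tfAdj_tfShift (w i) φ)
  rw [lintegral_finsetSum' _ fun k _ =>
    ((hc k).enorm.measurable.pow_const 2).aemeasurable]
  rw [← Finset.sum_fiberwise s j, Finset.mul_sum]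
  refine Finset.sum_congr rfl fun k _ => ?_
  have := setLIntegral_enorm_sum_tfAdj b (s.filter fun i => j i = k) w
    (fun i hi => hw i (Finset.mem_filter.1 hi).1) (fun i hi i' hi' h => hinj
      (Finset.mem_filter.1 hi).1 (Finset.mem_filter.1 hi').1
      (Prod.ext ((Finset.mem_filter.1 hi).2.trans (Finset.mem_filter.1 hi').2.symm) h))
    (fun i => conj (c i)) hφ
  simpa only [RCLike.enorm_conj, testVector] using this

/-- The conjugates and adjoints in `testVector` are chosen so that everything moves onto `g`.
Integrality of the symplectic pairings then lets `π_{w i}` pass through `π_l` without a phase. -/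
theorem sum_inner_testVector {J : Type*} (s : Finset J) (j : J → κ) (w : J → PhaseSpace d)
    (c : J → ℂ) (φ : L2 d ℂ) (z : PhaseSpace d) (g : κ → L2 d ℂ) {l : PhaseSpace d}
    (hw : ∀ i ∈ s, ∃ k : ℤ, sympl l (w i) = k) :
    ∑ k, inner ℂ (tfShift l (g k)) (testVector s j w c φ z k)
      = inner ℂ (tfShift l (∑ i ∈ s, c i • tfShift (w i) (g (j i)))) (tfShift z φ) := by
  rw [tfShift_sum, sum_inner, ← Finset.sum_fiberwise s j]
  refine Finset.sum_congr rfl fun k _ => ?_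
  rw [testVector, inner_sum]
  refine Finset.sum_congr rfl fun i hi => ?_
  obtain ⟨his, rfl⟩ := Finset.mem_filter.1 hi
  rw [inner_smul_right, ← inner_tfShift_eq_inner_tfAdj, tfShift_smul, inner_smul_left,
    tfShift_comm l (w i), (char_eq_one_iff _).2 (hw i his), one_smul]

/-- The lattice translates of the fundamental domain tile the plane, so sum and integral unfold to
the full integral of the squared short-time Fourier transform; phases vanish under the absolute
value. -/
theorem setLIntegral_tsum_inner_tfShift (G φ : L2 d ℂ) :
    ∫⁻ z in ZSpan.fundamentalDomain b, ∑' l : Submodule.span ℤ (Set.range b),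
      ‖(inner ℂ (tfShift (l : PhaseSpace d) G) (tfShift z φ) : ℂ)‖ₑ ^ 2 = ‖φ‖ₑ ^ 2 * ‖G‖ₑ ^ 2 := by
  have h1 := ZSpan.isAddFundamentalDomain b (volume : Measure (PhaseSpace d))
  have hm : ∀ G : L2 d ℂ, Measurable fun z : PhaseSpace d =>
      ‖(inner ℂ G (tfShift z φ) : ℂ)‖ₑ ^ 2 := fun G =>
    (continuous_const.inner (continuous_tfShift φ)).enorm.measurable.pow_const 2
  rw [lintegral_tsum fun l => (hm _).aemeasurable, ← lintegral_inner_tfShift_sq,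
    h1.lintegral_eq_tsum']
  refine tsum_congr fun l => lintegral_congr fun z => ?_
  congr 1
  rw [Submodule.vadd_def, vadd_eq_add, Submodule.coe_neg, inner_tfShift_add, enorm_mul, neg_neg,
    ← inner_conj_symm, RCLike.enorm_conj,
    enorm_char, one_mul]

/-- The lower frame bound over a lattice passes to a lower Riesz bound over its dual. -/
theorem le_enorm_sum_tfShift {J : Type*} (s : Finset J) (j : J → κ) (w : J → PhaseSpace d)
    (hw : ∀ i ∈ s, w i ∈ symplDual (Submodule.span ℤ (Set.range b) : Set (PhaseSpace d)))
    (hinj : Set.InjOn (fun i => (j i, w i)) s) (c : J → ℂ) (g : κ → L2 d ℂ) {A : ℝ≥0∞}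
    (h : ∀ f : κ → L2 d ℂ, A * ∑ k, ‖f k‖ₑ ^ 2 ≤ ∑' l : Submodule.span ℤ (Set.range b),
      ‖∑ k, (inner ℂ (tfShift (l : PhaseSpace d) (g k)) (f k) : ℂ)‖ₑ ^ 2) :
    A * (volume (ZSpan.fundamentalDomain b) * ∑ i ∈ s, ‖c i‖ₑ ^ 2)
      ≤ ‖∑ i ∈ s, c i • tfShift (w i) (g (j i))‖ₑ ^ 2 := by
  obtain ⟨φ, hφ⟩ := exists_norm_eq_one d
  have hφ' : ‖φ‖ₑ = 1 := by rw [← ofReal_norm, hφ, ENNReal.ofReal_one]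
  have e := setLIntegral_tsum_inner_tfShift b (∑ i ∈ s, c i • tfShift (w i) (g (j i))) φ
  rw [hφ', one_pow, one_mul] at e
  rw [← e, ← setLIntegral_testVector b s j w hw hinj c hφ]
  refine (lintegral_const_mul_le _ _).trans (lintegral_mono fun z => ?_)
  refine (h (testVector s j w c φ z)).trans_eq (tsum_congr fun l => ?_)
  rw [sum_inner_testVector s j w c φ z g fun i hi => hw i hi l l.2]

/-- The upper frame bound over a lattice passes to an upper Riesz bound over its dual. -/
theorem enorm_sum_tfShift_le {J : Type*} (s : Finset J) (j : J → κ) (w : J → PhaseSpace d)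
    (hw : ∀ i ∈ s, w i ∈ symplDual (Submodule.span ℤ (Set.range b) : Set (PhaseSpace d)))
    (hinj : Set.InjOn (fun i => (j i, w i)) s) (c : J → ℂ) (g : κ → L2 d ℂ) {B : ℝ≥0∞}
    (hB : B ≠ ⊤)
    (h : ∀ f : κ → L2 d ℂ, ∑' l : Submodule.span ℤ (Set.range b),
      ‖∑ k, (inner ℂ (tfShift (l : PhaseSpace d) (g k)) (f k) : ℂ)‖ₑ ^ 2
        ≤ B * ∑ k, ‖f k‖ₑ ^ 2) :
    ‖∑ i ∈ s, c i • tfShift (w i) (g (j i))‖ₑ ^ 2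
      ≤ B * (volume (ZSpan.fundamentalDomain b) * ∑ i ∈ s, ‖c i‖ₑ ^ 2) := by
  obtain ⟨φ, hφ⟩ := exists_norm_eq_one d
  have hφ' : ‖φ‖ₑ = 1 := by rw [← ofReal_norm, hφ, ENNReal.ofReal_one]
  have e := setLIntegral_tsum_inner_tfShift b (∑ i ∈ s, c i • tfShift (w i) (g (j i))) φ
  rw [hφ', one_pow, one_mul] at e
  rw [← e, ← setLIntegral_testVector b s j w hw hinj c hφ, ← lintegral_const_mul' _ _ hB]
  refine lintegral_mono fun z => ?_
  refine le_of_eq_of_le (tsum_congr fun l => ?_) (h (testVector s j w c φ z))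
  rw [sum_inner_testVector s j w c φ z g fun i hi => hw i hi l l.2]

end Lattice

/-! ### The symplectic dual of a lattice -/

section DualLattice

variable {d : ℕ}

/-- The symplectic form as a bilinear form, with its arguments swapped. -/
def symplForm (d : ℕ) : LinearMap.BilinForm ℝ (PhaseSpace d) :=
  LinearMap.mk₂ ℝ (fun w z => sympl z w) (fun w v z => sympl_add_right z w v)
    (fun r w z => sympl_smul_right r z w) (fun w z v => sympl_add_left z v w)
    (fun r w z => sympl_smul_left r z w)

@[simp] theorem symplForm_apply (w z : PhaseSpace d) : symplForm d w z = sympl z w := rfl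

theorem symplForm_nondegenerate (d : ℕ) : (symplForm d).Nondegenerate := by
  constructor
  · intro w h
    by_contra hw
    obtain ⟨v, hv⟩ := exists_char_sympl_ne_one hw
    rw [← symplForm_apply, h v, char_zero] at hv
    exact hv rfl
  · intro w h
    by_contra hw
    obtain ⟨v, hv⟩ := exists_char_sympl_ne_one hw
    rw [sympl_swap, ← symplForm_apply, h v, neg_zero, char_zero] at hv
    exact hv rfl

variable {ι : Type*} [Finite ι] [DecidableEq ι] (b : Module.Basis ι ℝ (PhaseSpace d))

/-- The basis dual to `b` with respect to the symplectic form. -/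
def symplBasis : Module.Basis ι ℝ (PhaseSpace d) :=
  (symplForm d).dualBasis (symplForm_nondegenerate d) b

theorem sympl_symplBasis (i j : ι) : sympl (b j) (symplBasis b i) = if j = i then 1 else 0 :=
  (symplForm d).apply_dualBasis_left (symplForm_nondegenerate d) b i j

/-- The dual is again a lattice with an explicit basis, so the averaging estimates also apply with
the dual as the starting lattice. -/
theorem symplDual_span :
    symplDual (Submodule.span ℤ (Set.range b) : Set (PhaseSpace d))
      = (Submodule.span ℤ (Set.range (symplBasis b)) : Set (PhaseSpace d)) := by
  rw [symplBasis, ← LinearMap.BilinForm.dualSubmodule_span_of_basis]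
  ext w
  simp only [symplDual, Set.mem_ofPred_eq, SetLike.mem_coe, LinearMap.BilinForm.mem_dualSubmodule,
    Submodule.mem_one, symplForm_apply]
  refine forall₂_congr fun l _ => exists_congr fun k => ?_
  rw [eq_comm]
  rfl

theorem subset_symplDual_symplDual (S : Set (PhaseSpace d)) : S ⊆ symplDual (symplDual S) := by
  intro l hl w hw
  obtain ⟨k, hk⟩ := hw l hl
  exact ⟨-k, by rw [sympl_swap, hk]; push_cast; rfl⟩

end DualLattice

/-! ### Fourier series of lattice-periodic functions -/

section FourierSeries

open UnitAddTorus

theorem isOpenQuotientMap_torus (ι : Type*) [Fintype ι] :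
    IsOpenQuotientMap (fun (s : ι → ℝ) (i : ι) => (s i : UnitAddCircle)) :=
  IsOpenQuotientMap.piMap fun _ => QuotientAddGroup.isOpenQuotientMap_mk

theorem mFourier_coe {ι : Type*} [Fintype ι] (n : ι → ℤ) (s : ι → ℝ) :
    mFourier n (fun i => (s i : UnitAddCircle)) = char (∑ i, n i * s i) := by
  simp only [mFourier, ContinuousMap.coe_mk, fourier_coe_apply, char]
  rw [← Complex.exp_sum]
  congr 1
  push_cast
  rw [Finset.mul_sum]
  refine Finset.sum_congr rfl fun i _ => ?_
  simp only [div_one, mul_assoc]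

/-- A continuous `ℤ^ι`-periodic function all of whose nonzero Fourier coefficients vanish is equal
to its mean value. -/
theorem apply_zero_eq_integral_of_periodic {ι : Type*} [Fintype ι] {F : (ι → ℝ) → ℂ}
    (hF : Continuous F) (hper : ∀ (s : ι → ℝ) (n : ι → ℤ), F (fun i => s i + n i) = F s)
    (hz : ∀ n : ι → ℤ, n ≠ 0 →
      ∫ s in Set.univ.pi fun _ : ι => Set.Ioc (0 : ℝ) 1, char (∑ i, n i * s i) * F s = 0) :
    F 0 = ∫ s in Set.univ.pi fun _ : ι => Set.Ioc (0 : ℝ) 1, F s := by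
  have hq := (isOpenQuotientMap_torus ι).isQuotientMap
  -- Integer periodicity makes `F` descend to a continuous function on the torus.
  have hfac : Function.FactorsThrough F fun (s : ι → ℝ) (i : ι) => (s i : UnitAddCircle) := by
    intro s t hst
    have h1 : ∀ i, ∃ n : ℤ, s i = t i + n := by
      intro i
      have h2 : ((s i - t i : ℝ) : UnitAddCircle) = 0 := by
        rw [AddCircle.coe_sub, sub_eq_zero]
        exact congrFun hst i
      obtain ⟨n, hn⟩ := (AddCircle.coe_eq_zero_iff _).1 h2
      refine ⟨n, ?_⟩
      rw [zsmul_one] at hn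
      rw [hn]; ring
    choose n hn using h1
    rw [← hper t n]
    exact congrArg F (funext hn)
  obtain ⟨Ft, hFt⟩ : ∃ Ft : C(UnitAddTorus ι, ℂ),
      ∀ s : ι → ℝ, Ft (fun i => (s i : UnitAddCircle)) = F s := by
    let q : C(ι → ℝ, UnitAddTorus ι) := ⟨_, hq.continuous⟩
    have hq' : Topology.IsQuotientMap q := hq
    exact ⟨hq'.lift ⟨F, hF⟩ hfac, fun s => DFunLike.congr_fun (hq'.lift_comp ⟨F, hF⟩ hfac) s⟩
  have hset : {x : ι → ℝ | ∀ i, x i ∈ Set.Ioc ((0 : ι → ℝ) i) ((0 : ι → ℝ) i + 1)}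
      = Set.univ.pi fun _ : ι => Set.Ioc (0 : ℝ) 1 := by
    ext x; simp [Set.mem_pi]
  have hcoef : ∀ n : ι → ℤ, mFourierCoeff Ft n
      = ∫ s in Set.univ.pi fun _ : ι => Set.Ioc (0 : ℝ) 1,
        char (∑ i, (-n) i * s i) * F s := by
    intro n
    rw [mFourierCoeff_eq_integral _ n 0, hset]
    refine integral_congr_ae (Filter.Eventually.of_forall fun s => ?_)
    simp only [hFt, mFourier_coe, smul_eq_mul]
  have hcoef0 : ∀ n : ι → ℤ, n ≠ 0 → mFourierCoeff Ft n = 0 := fun n hn => by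
    rw [hcoef, ← hz (-n) (neg_ne_zero.2 hn)]
  -- Only the zeroth coefficient can be nonzero, so the coefficients are summable and the Fourier
  -- series of the continuous function converges to it at every point.
  have hsum : Summable (mFourierCoeff Ft) :=
    summable_of_ne_finset_zero (s := {0}) fun n hn => hcoef0 n (by simpa using hn)
  have h := hasSum_mFourier_series_apply_of_summable hsum (fun _ => ((0 : ℝ) : UnitAddCircle))
  have h' := h.unique (hasSum_single 0 fun n hn => by rw [hcoef0 n hn, zero_smul])
  rw [hFt (fun _ => 0)] at h'
  change F (fun _ => 0) = _
  rw [h', mFourier_zero, hcoef 0]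
  simp

variable {d : ℕ} {ι : Type*} [Fintype ι] (b : Module.Basis ι ℝ (PhaseSpace d))

/-- Uniqueness of Haar measure: the coordinate map of `b` carries Lebesgue measure to a multiple `c`
of Lebesgue measure. The cubes `Ioc` and `Ico` differ by a null set. -/
theorem exists_setIntegral_fundamentalDomain_eq :
    ∃ c : ℝ, 0 < c ∧ ∀ F : PhaseSpace d → ℂ,
      ∫ s in Set.univ.pi fun _ : ι => Set.Ioc (0 : ℝ) 1, F (∑ i, s i • b i)
        = c * ∫ z in ZSpan.fundamentalDomain b, F z := by
  let e : (ι → ℝ) ≃L[ℝ] PhaseSpace d := b.equivFun.symm.toContinuousLinearEquiv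
  have he : ∀ s, e s = ∑ i, s i • b i := fun s => b.equivFun_symm_apply s
  have hμ : (Measure.map e volume).IsAddHaarMeasure := e.isAddHaarMeasure_map volume
  obtain ⟨c, hc0, hc⟩ : ∃ c : NNReal, 0 < c ∧
      Measure.map e (volume : Measure (ι → ℝ)) = c • (volume : Measure (PhaseSpace d)) :=
    ⟨_, Measure.addHaarScalarFactor_pos_of_isAddHaarMeasure _ _,
      Measure.isAddLeftInvariant_eq_smul _ _⟩
  refine ⟨c, NNReal.coe_pos.2 hc0, fun F => ?_⟩
  have h1 : (Set.univ.pi fun _ : ι => Set.Ioc (0 : ℝ) 1) =ᵐ[volume]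
      (Set.univ.pi fun _ : ι => Set.Ico (0 : ℝ) 1) :=
    (Measure.univ_pi_Ioc_ae_eq_Icc (f := fun _ : ι => (0 : ℝ)) (g := fun _ => 1)).trans
      Measure.univ_pi_Ico_ae_eq_Icc.symm
  have h2 : (Set.univ.pi fun _ : ι => Set.Ico (0 : ℝ) 1) = e ⁻¹' ZSpan.fundamentalDomain b := by
    ext s
    simp only [Set.mem_pi, Set.mem_univ, true_implies, Set.mem_preimage,
      ZSpan.mem_fundamentalDomain]
    refine forall_congr' fun i => ?_
    have : b.repr (e s) i = s i := by
      rw [he, b.repr_sum_self]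
    rw [this]
  rw [setIntegral_congr_set h1, h2]
  have h3 : MeasurableEmbedding e := e.toHomeomorph.measurableEmbedding
  simp_rw [← he]
  rw [← h3.setIntegral_map (μ := volume) F, hc, Measure.restrict_smul, integral_smul_nnreal_measure,
    NNReal.smul_def, Complex.real_smul]

variable [DecidableEq ι]

/-- A continuous function periodic with respect to a lattice, all of whose nonzero Fourier
coefficients vanish, is a multiple of its integral over a fundamental domain. -/
theorem exists_apply_zero_eq_mul_setIntegral :
    ∃ c : ℝ, 0 < c ∧ ∀ F : PhaseSpace d → ℂ, Continuous F →
      (∀ l ∈ Submodule.span ℤ (Set.range b), ∀ z, F (l + z) = F z) →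
      (∀ w ∈ symplDual (Submodule.span ℤ (Set.range b) : Set (PhaseSpace d)), w ≠ 0 →
        ∫ z in ZSpan.fundamentalDomain b, char (sympl z w) * F z = 0) →
      F 0 = c * ∫ z in ZSpan.fundamentalDomain b, F z := by
  obtain ⟨c, hc, h⟩ := exists_setIntegral_fundamentalDomain_eq b
  refine ⟨c, hc, fun F hF hper hz => ?_⟩
  rw [← h]
  have h0 : F 0 = (fun s : ι → ℝ => F (∑ i, s i • b i)) 0 := by simp
  rw [h0]
  have hcont : Continuous fun s : ι → ℝ => ∑ i, s i • b i := by fun_prop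
  refine apply_zero_eq_integral_of_periodic (hF.comp hcont) (fun s n => ?_) (fun n hn => ?_)
  · have hl : ∑ i, n i • b i ∈ Submodule.span ℤ (Set.range b) :=
      Submodule.sum_mem _ fun i _ => Submodule.smul_mem _ _ (Submodule.subset_span ⟨i, rfl⟩)
    simp only [Function.comp_apply]
    rw [← hper _ hl (∑ i, s i • b i)]
    congr 1
    simp only [add_smul, Finset.sum_add_distrib, Int.cast_smul_eq_zsmul]
    rw [add_comm]
  · let w : PhaseSpace d := ∑ i, n i • symplBasis b i
    have hw : w ∈ symplDual (Submodule.span ℤ (Set.range b) : Set (PhaseSpace d)) := by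
      rw [symplDual_span]
      exact Submodule.sum_mem _ fun i _ => Submodule.smul_mem _ _ (Submodule.subset_span ⟨i, rfl⟩)
    have hsw : ∀ s : ι → ℝ, sympl (∑ i, s i • b i) w = ∑ i, n i * s i := by
      intro s
      have : w = ∑ i, (n i : ℝ) • symplBasis b i := by simp [w, Int.cast_smul_eq_zsmul]
      rw [this, ← symplForm_apply]
      simp only [map_sum, map_smul, LinearMap.sum_apply, LinearMap.smul_apply, symplForm_apply,
        sympl_symplBasis, smul_eq_mul]
      simp [mul_comm]
    have hw0 : w ≠ 0 := by
      intro hw0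
      have h1 := (symplBasis b).linearIndependent
      rw [Fintype.linearIndependent_iff] at h1
      refine hn (funext fun i => ?_)
      have h2 := h1 (fun i => (n i : ℝ)) (by simpa [w, Int.cast_smul_eq_zsmul] using hw0) i
      exact_mod_cast h2
    have h1 := h fun z => char (sympl z w) * F z
    simp only [hsw] at h1
    simp only [Function.comp_apply]
    rw [h1, hz w hw hw0, mul_zero]

end FourierSeries

/-! ### Bessel families, Riesz bounds and biorthogonal families -/

section HilbertFamilies

variable {ι H : Type*} [NormedAddCommGroup H] [InnerProductSpace ℂ H]

/-- The Bessel inequality with bound `B`, for finite partial sums. -/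
def IsBessel (φ : ι → H) (B : ℝ) : Prop :=
  ∀ (s : Finset ι) (f : H), ∑ i ∈ s, ‖(inner ℂ (φ i) f : ℂ)‖ ^ 2 ≤ B * ‖f‖ ^ 2

/-- A synthesis bound for a family yields the Bessel inequality. -/
theorem isBessel_of_synthesis {φ : ι → H} {B : ℝ} (hB : 0 ≤ B)
    (h : ∀ (s : Finset ι) (c : ι → ℂ), ‖∑ i ∈ s, c i • φ i‖ ^ 2 ≤ B * ∑ i ∈ s, ‖c i‖ ^ 2) :
    IsBessel φ B := by
  intro s f
  set S := ∑ i ∈ s, ‖(inner ℂ (φ i) f : ℂ)‖ ^ 2 with hS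
  have hS0 : 0 ≤ S := Finset.sum_nonneg fun i _ => by positivity
  -- Duality: with the analysis coefficients as synthesis coefficients, the inner product of the sum
  -- with `f` is `S` itself. Cauchy–Schwarz then gives `S² ≤ B S ‖f‖²`.
  have h1 := h s fun i => inner ℂ (φ i) f
  rw [← hS] at h1
  have h2 : (inner ℂ (∑ i ∈ s, (inner ℂ (φ i) f : ℂ) • φ i) f : ℂ) = (S : ℂ) := by
    rw [sum_inner, hS, Complex.ofReal_sum]
    refine Finset.sum_congr rfl fun i _ => ?_
    rw [inner_smul_left, Complex.conj_mul', Complex.ofReal_pow]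
  have h3 := norm_inner_le_norm (𝕜 := ℂ) (∑ i ∈ s, (inner ℂ (φ i) f : ℂ) • φ i) f
  rw [h2, Complex.norm_real, Real.norm_of_nonneg hS0] at h3
  have h4 : S ^ 2 ≤ B * S * ‖f‖ ^ 2 := by
    calc S ^ 2 ≤ (‖∑ i ∈ s, (inner ℂ (φ i) f : ℂ) • φ i‖ * ‖f‖) ^ 2 := by gcongr
      _ = ‖∑ i ∈ s, (inner ℂ (φ i) f : ℂ) • φ i‖ ^ 2 * ‖f‖ ^ 2 := by ring
      _ ≤ B * S * ‖f‖ ^ 2 := by gcongr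
  rcases hS0.eq_or_lt with h0 | h0
  · rw [← h0]; positivity
  · refine le_of_mul_le_mul_left ?_ h0
    linarith

/-- The analysis operator of a Bessel family. -/
def analysisOp {φ : ι → H} {B : ℝ} (hB : 0 ≤ B) (h : IsBessel φ B) :
    H →L[ℂ] lp (fun _ : ι => ℂ) 2 :=
  LinearMap.mkContinuous
    { toFun := fun f => ⟨fun i => inner ℂ (φ i) f, memℓp_gen' (C := B * ‖f‖ ^ 2) fun s => by
        simpa using h s f⟩
      map_add' := fun f g => by ext i; exact inner_add_right _ _ _
      map_smul' := fun c f => by ext i; exact inner_smul_right _ _ _ } (√B) fun f => by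
    refine lp.norm_le_of_forall_sum_le (by simp) (by positivity) fun s => ?_
    simpa [mul_pow, Real.sq_sqrt hB] using h s f

theorem norm_analysisOp_le {φ : ι → H} {B : ℝ} (hB : 0 ≤ B) (h : IsBessel φ B) (f : H) :
    ‖analysisOp hB h f‖ ≤ √B * ‖f‖ :=
  ContinuousLinearMap.le_of_opNorm_le _
    (LinearMap.mkContinuous_norm_le _ (Real.sqrt_nonneg _) _) f

/-- The lower Riesz inequality with bound `A`. -/
def HasLowerRieszBound (φ : ι → H) (A : ℝ) : Prop :=
  ∀ (s : Finset ι) (c : ι → ℂ), A * ∑ i ∈ s, ‖c i‖ ^ 2 ≤ ‖∑ i ∈ s, c i • φ i‖ ^ 2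

/-- For `v` in the span of the other vectors, `φ i - v` is a combination in which `φ i` has
coefficient `1`, so its square norm is at least `A`. The inequality is closed in `v`. -/
theorem HasLowerRieszBound.le_norm_sub_sq {φ : ι → H} {A : ℝ} (hA : 0 ≤ A)
    (h : HasLowerRieszBound φ A) (i : ι) {v : H}
    (hv : v ∈ (Submodule.span ℂ (φ '' {i}ᶜ)).topologicalClosure) : A ≤ ‖φ i - v‖ ^ 2 := by
  classical
  have hcl : IsClosed {v : H | A ≤ ‖φ i - v‖ ^ 2} :=
    isClosed_le continuous_const (by fun_prop)
  refine closure_minimal ?_ hcl hv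
  intro v hv
  obtain ⟨c, hc, rfl⟩ := (Finsupp.mem_span_image_iff_linearCombination ℂ).1 hv
  have hci : i ∉ c.support := fun hi => by
    have := (Finsupp.mem_supported ℂ c).1 hc hi
    simp at this
  let e : ι → ℂ := fun k => if k = i then 1 else -c k
  have h1 := h (insert i c.support) e
  have hne : ∀ k ∈ c.support, k ≠ i := fun k hk hki => hci (hki ▸ hk)
  have hsum : ∑ k ∈ c.support, e k • φ k = -∑ k ∈ c.support, c k • φ k := by
    rw [← Finset.sum_neg_distrib]
    refine Finset.sum_congr rfl fun k hk => ?_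
    simp [e, hne k hk]
  rw [Finset.sum_insert hci, Finset.sum_insert hci, hsum] at h1
  simp only [e, if_true, one_smul, norm_one, one_pow, ← sub_eq_add_neg] at h1
  rw [Set.mem_ofPred_eq, Finsupp.linearCombination_apply, Finsupp.sum]
  refine le_trans ?_ h1
  have : 0 ≤ ∑ k ∈ c.support, ‖if k = i then (1 : ℂ) else -c k‖ ^ 2 :=
    Finset.sum_nonneg fun k _ => by positivity
  nlinarith

/-- A family with a lower Riesz bound has biorthogonal vectors in its closed span. -/
theorem HasLowerRieszBound.exists_biorthogonal [CompleteSpace H] {φ : ι → H} {A : ℝ} (hA : 0 < A)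
    (h : HasLowerRieszBound φ A) (i : ι) :
    ∃ γ ∈ (Submodule.span ℂ (Set.range φ)).topologicalClosure,
      inner ℂ γ (φ i) = (1 : ℂ) ∧ ∀ k, k ≠ i → inner ℂ γ (φ k) = (0 : ℂ) := by
  set W := (Submodule.span ℂ (φ '' {i}ᶜ)).topologicalClosure with hW
  have : CompleteSpace W := (Submodule.isClosed_topologicalClosure _).completeSpace_coe
  -- The biorthogonal vector is the component of `φ i` orthogonal to the closed span of the others,
  -- nonzero by the distance estimate and later divided by its square norm.
  set P : H := W.starProjection (φ i)
  set γ : H := φ i - P with hγ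
  have hPW : P ∈ W := W.starProjection_apply_mem _
  have hγW : ∀ v ∈ W, inner ℂ γ v = (0 : ℂ) := fun v hv =>
    W.starProjection_inner_eq_zero _ v hv
  have hpos : 0 < ‖γ‖ ^ 2 := hA.trans_le (h.le_norm_sub_sq hA.le i hPW)
  have hγi : inner ℂ γ (φ i) = ((‖γ‖ ^ 2 : ℝ) : ℂ) := by
    have h1 : φ i = γ + P := by rw [hγ]; abel
    conv_lhs => rw [h1, inner_add_right, hγW P hPW, add_zero]
    rw [inner_self_eq_norm_sq_to_K]
    norm_cast
  have hWV : W ≤ (Submodule.span ℂ (Set.range φ)).topologicalClosure :=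
    Submodule.topologicalClosure_mono (Submodule.span_mono (Set.image_subset_range _ _))
  have hφV : ∀ k, φ k ∈ (Submodule.span ℂ (Set.range φ)).topologicalClosure := fun k =>
    Submodule.le_topologicalClosure _ (Submodule.subset_span ⟨k, rfl⟩)
  refine ⟨(((‖γ‖ ^ 2)⁻¹ : ℝ) : ℂ) • γ, Submodule.smul_mem _ _
    (Submodule.sub_mem _ (hφV i) (hWV hPW)), ?_, fun k hk => ?_⟩
  · rw [inner_smul_left, Complex.conj_ofReal, hγi, ← Complex.ofReal_mul,
      inv_mul_cancel₀ hpos.ne', Complex.ofReal_one]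
  · rw [inner_smul_left, hγW, mul_zero]
    exact Submodule.le_topologicalClosure _ (Submodule.subset_span ⟨k, by simpa using hk, rfl⟩)

/-- The biorthogonal family of a family with lower Riesz bound `A` is Bessel with bound `A⁻¹`. -/
theorem HasLowerRieszBound.isBessel_biorthogonal [CompleteSpace H] {φ γ : ι → H} {A : ℝ}
    (hA : 0 < A) (h : HasLowerRieszBound φ A)
    (hγ : ∀ i, γ i ∈ (Submodule.span ℂ (Set.range φ)).topologicalClosure)
    (h1 : ∀ i, inner ℂ (γ i) (φ i) = (1 : ℂ)) (h0 : ∀ i k, k ≠ i → inner ℂ (γ i) (φ k) = (0 : ℂ)) :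
    IsBessel γ A⁻¹ := by
  classical
  intro s f
  set V := (Submodule.span ℂ (Set.range φ)).topologicalClosure with hV
  have : CompleteSpace V := (Submodule.isClosed_topologicalClosure _).completeSpace_coe
  -- On the span, `⟨γ i, v⟩` reads off the coefficients of `v`, so the claim is the lower Riesz
  -- inequality; both sides are continuous in `v`.
  have hmem : ∀ v ∈ V, ∑ i ∈ s, ‖(inner ℂ (γ i) v : ℂ)‖ ^ 2 ≤ A⁻¹ * ‖v‖ ^ 2 := by
    intro v hv
    have hcl : IsClosed {v : H | ∑ i ∈ s, ‖(inner ℂ (γ i) v : ℂ)‖ ^ 2 ≤ A⁻¹ * ‖v‖ ^ 2} :=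
      isClosed_le (by fun_prop) (by fun_prop)
    refine closure_minimal ?_ hcl hv
    intro v hv
    obtain ⟨c, rfl⟩ := Finsupp.mem_span_range_iff_exists_finsupp.1 hv
    have hc : ∀ i, inner ℂ (γ i) (c.sum fun k a => a • φ k) = c i := by
      intro i
      rw [Finsupp.sum, inner_sum]
      simp_rw [inner_smul_right]
      rw [Finset.sum_eq_single i]
      · rw [h1, mul_one]
      · intro k _ hk; rw [h0 i k hk, mul_zero]
      · intro hi; rw [Finsupp.notMem_support_iff.1 hi, zero_mul]
    simp only [Set.mem_ofPred_eq, hc]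
    have h2 := h (s ∪ c.support) c
    have h3 : ∑ k ∈ s ∪ c.support, c k • φ k = c.sum fun k a => a • φ k := by
      rw [Finsupp.sum]
      refine (Finset.sum_subset Finset.subset_union_right fun k _ hk => ?_).symm
      rw [Finsupp.notMem_support_iff.1 hk, zero_smul]
    rw [h3] at h2
    have h4 : ∑ k ∈ s, ‖c k‖ ^ 2 ≤ ∑ k ∈ s ∪ c.support, ‖c k‖ ^ 2 :=
      Finset.sum_le_sum_of_subset_of_nonneg Finset.subset_union_left fun _ _ _ => by positivity
    rw [inv_mul_eq_div, le_div_iff₀' hA]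
    exact (mul_le_mul_of_nonneg_left h4 hA.le).trans h2
  -- Since each `γ i` lies in `V`, a general `f` may be replaced by its projection, which does not
  -- increase the norm.
  have hP : ∀ i, inner ℂ (γ i) f = (inner ℂ (γ i) (V.starProjection f) : ℂ) := by
    intro i
    have h2 : inner ℂ (γ i) (f - V.starProjection f) = (0 : ℂ) := by
      rw [← inner_conj_symm, V.starProjection_inner_eq_zero _ _ (hγ i), map_zero]
    rw [inner_sub_right, sub_eq_zero] at h2
    exact h2
  simp_rw [hP]
  refine (hmem _ (V.starProjection_apply_mem f)).trans ?_
  have : ‖V.starProjection f‖ ≤ ‖f‖ := V.norm_starProjection_apply_le f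
  gcongr

end HilbertFamilies

/-! ### The Wexler–Raz identity -/

section WexlerRaz

variable {d : ℕ}

/-- The character is absorbed by shifting both `g` and `h` by `w`, since it is the commutation phase
of `π_z` and `π_w`. What remains is the orthogonality relation. -/
theorem integral_char_sympl_mul_inner (γ g f h : L2 d ℂ) (w : PhaseSpace d) :
    ∫ z : PhaseSpace d, char (sympl z w) *
        (inner ℂ (tfShift z γ) f * conj (inner ℂ (tfShift z g) h))
      = inner ℂ (tfShift w h) f * inner ℂ γ (tfShift w g) := by
  rw [← integral_inner_mul_conj]
  refine integral_congr_ae (Filter.Eventually.of_forall fun z => ?_)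
  have h1 : (inner ℂ (tfShift z (tfShift w g)) (tfShift w h) : ℂ)
      = conj (char (sympl z w)) * inner ℂ (tfShift z g) h := by
    rw [tfShift_comm, inner_smul_left, inner_tfShift_tfShift]
  simp only [h1, map_mul, RCLike.conj_conj]
  ring

theorem integrable_char_sympl_mul_inner (γ g f h : L2 d ℂ) (w : PhaseSpace d) :
    Integrable fun z : PhaseSpace d => char (sympl z w) *
      (inner ℂ (tfShift z γ) f * conj (inner ℂ (tfShift z g) h)) :=
  (integrable_inner_mul_conj γ g f h).bdd_mul (c := 1)
    (Continuous.aestronglyMeasurable (by fun_prop))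
    (Filter.Eventually.of_forall fun z => (norm_char _).le)

theorem continuous_tfShift_neg (f : L2 d ℂ) : Continuous fun z : PhaseSpace d => tfShift (-z) f :=
  (continuous_tfShift f).comp continuous_neg

/-- The phases of the two factors cancel under a translation. -/
theorem inner_mul_conj_inner_tfShift_add (z l : PhaseSpace d) (γ g f h : L2 d ℂ) :
    inner ℂ (tfShift (z + l) γ) f * conj (inner ℂ (tfShift (z + l) g) h)
      = inner ℂ (tfShift l γ) (tfShift (-z) f) * conj (inner ℂ (tfShift l g) (tfShift (-z) h)) := by
  rw [inner_tfShift_add, inner_tfShift_add, map_mul, mul_mul_mul_comm, char_mul_conj, one_mul]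

variable {ι : Type*} [Fintype ι] (b : Module.Basis ι ℝ (PhaseSpace d))

/-- This computes the Fourier coefficients of the periodised product. For `w` in the dual lattice
the character is periodic, so the integral unfolds to the whole plane; integrability there justifies
exchanging sum and integral. -/
theorem setIntegral_char_sympl_mul_tsum (γ g f h : L2 d ℂ) {w : PhaseSpace d}
    (hw : w ∈ symplDual (Submodule.span ℤ (Set.range b) : Set (PhaseSpace d))) :
    ∫ z in ZSpan.fundamentalDomain b, char (sympl z w) *
        ∑' l : Submodule.span ℤ (Set.range b), inner ℂ (tfShift (l : PhaseSpace d) γ)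
          (tfShift (-z) f) * conj (inner ℂ (tfShift (l : PhaseSpace d) g) (tfShift (-z) h))
      = inner ℂ (tfShift w h) f * inner ℂ γ (tfShift w g) := by
  rw [← integral_char_sympl_mul_inner]
  have h1 := ZSpan.isAddFundamentalDomain b (volume : Measure (PhaseSpace d))
  set Ψ : PhaseSpace d → ℂ := fun z => char (sympl z w) *
    (inner ℂ (tfShift z γ) f * conj (inner ℂ (tfShift z g) h)) with hΨ
  have hΨi : Integrable Ψ := integrable_char_sympl_mul_inner γ g f h w
  have hterm : ∀ (l : Submodule.span ℤ (Set.range b)) (z : PhaseSpace d),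
      Ψ (l +ᵥ z) = char (sympl z w) * (inner ℂ (tfShift (l : PhaseSpace d) γ)
        (tfShift (-z) f) * conj (inner ℂ (tfShift (l : PhaseSpace d) g) (tfShift (-z) h))) := by
    intro l z
    rw [Submodule.vadd_def, vadd_eq_add]
    simp only [hΨ]
    rw [sympl_add_left, char_add, (char_eq_one_iff _).2 (hw l l.2), one_mul,
      add_comm (l : PhaseSpace d) z,
      inner_mul_conj_inner_tfShift_add]
  rw [h1.integral_eq_tsum'' Ψ hΨi, ← integral_tsum]
  · refine integral_congr_ae (Filter.Eventually.of_forall fun z => ?_)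
    simp only [hterm]
    rw [tsum_mul_left]
  · intro l
    have hc : Continuous Ψ := by
      simp only [hΨ]
      exact ((continuous_char.comp (continuous_sympl_left w))).mul
        ((continuous_inner_tfShift γ f).mul
          (Complex.continuous_conj.comp (continuous_inner_tfShift g h)))
    exact (hc.comp (continuous_const_vadd l)).aestronglyMeasurable
  · rw [← h1.lintegral_eq_tsum'' fun z => ‖Ψ z‖ₑ]
    exact hΨi.2.ne

variable [DecidableEq ι]

/-- The Wexler–Raz identity: if `γ` is orthogonal to `π_w g` for all nonzero `w` in the dual
lattice, then the mixed frame operator of `g` and `γ` is a multiple of the identity. -/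
theorem exists_wexlerRaz_constant :
    ∃ c : ℝ, 0 < c ∧ ∀ (γ g : L2 d ℂ) (B B' : ℝ) (hB : 0 ≤ B) (hB' : 0 ≤ B')
      (hγ : IsBessel (gaborSystem γ (Submodule.span ℤ (Set.range b) : Set (PhaseSpace d))) B)
      (hg : IsBessel (gaborSystem g (Submodule.span ℤ (Set.range b) : Set (PhaseSpace d))) B'),
      (∀ w ∈ symplDual (Submodule.span ℤ (Set.range b) : Set (PhaseSpace d)), w ≠ 0 →
        inner ℂ γ (tfShift w g) = (0 : ℂ)) →
      ∀ f h : L2 d ℂ, inner ℂ (analysisOp hB' hg h) (analysisOp hB hγ f)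
        = c * (inner ℂ h f * inner ℂ γ g) := by
  obtain ⟨c, hc, hF⟩ := exists_apply_zero_eq_mul_setIntegral b
  refine ⟨c, hc, fun γ g B B' hB hB' hγ hg horth f h => ?_⟩
  have hinner : ∀ u v : L2 d ℂ, inner ℂ (analysisOp hB' hg v) (analysisOp hB hγ u)
      = ∑' l : Submodule.span ℤ (Set.range b), inner ℂ (tfShift (l : PhaseSpace d) γ) u *
        conj (inner ℂ (tfShift (l : PhaseSpace d) g) v) := by
    intro u v
    rw [lp.inner_eq_tsum]
    rfl
  have hint := fun w hw => setIntegral_char_sympl_mul_tsum b γ g f h (w := w) hw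
  have h0 : (0 : PhaseSpace d) ∈
      symplDual (Submodule.span ℤ (Set.range b) : Set (PhaseSpace d)) := by
    intro l _; exact ⟨0, by simp [sympl]⟩
  have key := hF (fun z => inner ℂ (analysisOp hB' hg (tfShift (-z) h))
      (analysisOp hB hγ (tfShift (-z) f))) ?_ ?_ ?_
  · simp only [neg_zero, tfShift_zero] at key
    rw [key]
    congr 1
    have := hint 0 h0
    simp only [tfShift_zero, sympl, Prod.snd_zero, Prod.fst_zero, inner_zero_right,
      inner_zero_left, sub_self, char_zero, one_mul] at this
    simp only [hinner]
    exact this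
  -- The Bessel hypotheses enter here: bounded analysis operators composed with strongly continuous
  -- shifts make the periodised function continuous.
  · exact ((analysisOp hB' hg).continuous.comp (continuous_tfShift_neg h)).inner
      ((analysisOp hB hγ).continuous.comp (continuous_tfShift_neg f))
  · intro l hl z
    simp only [hinner]
    simp_rw [← inner_mul_conj_inner_tfShift_add]
    have h2 := (Equiv.addRight (⟨l, hl⟩ : Submodule.span ℤ (Set.range b))).tsum_eq
      (fun m => inner ℂ (tfShift (z + (m : PhaseSpace d)) γ) f *
        conj (inner ℂ (tfShift (z + (m : PhaseSpace d)) g) h))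
    rw [← h2]
    refine tsum_congr fun m => ?_
    have h3 : l + z + (m : PhaseSpace d) = z + ((m : PhaseSpace d) + l) := by abel
    rw [h3]
    rfl
  · intro w hw hw0
    simp only [hinner]
    rw [hint w hw, horth w hw hw0, mul_zero]

end WexlerRaz

/-! ### Vector-valued functions and their components -/

section Components

variable {d n : ℕ}

theorem coeFn_component (g : L2 d (EuclideanSpace ℂ (Fin n))) (j : Fin n) :
    component g j =ᵐ[volume] fun t => g t j :=
  ContinuousLinearMap.coeFn_compLp' _ g

theorem component_tfShift (z : PhaseSpace d) (g : L2 d (EuclideanSpace ℂ (Fin n))) (j : Fin n) :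
    component (tfShift z g) j = tfShift z (component g j) := by
  apply Lp.ext
  have h := (measurePreserving_sub_right (volume : Measure (EuclideanSpace ℝ (Fin d)))
    z.1).quasiMeasurePreserving.ae_eq_comp (coeFn_component g j)
  filter_upwards [coeFn_component (tfShift z g) j, coeFn_tfShift' z g,
    coeFn_tfShift' z (component g j), h] with t h1 h2 h3 h4
  simp only [Function.comp_apply] at h4
  rw [h1, h2, h3, h4, PiLp.smul_apply]

theorem inner_eq_sum_component (g f : L2 d (EuclideanSpace ℂ (Fin n))) :
    (inner ℂ g f : ℂ) = ∑ j, inner ℂ (component g j) (component f j) := by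
  simp only [L2.inner_def]
  rw [← integral_finsetSum _ fun j _ => L2.integrable_inner _ _]
  refine integral_congr_ae ?_
  have h : ∀ f : L2 d (EuclideanSpace ℂ (Fin n)), ∀ᵐ t, ∀ j, component f j t = f t j :=
    fun f => ae_all_iff.2 fun j => coeFn_component f j
  filter_upwards [h f, h g] with t h1 h2
  simp only [h1, h2]
  rw [PiLp.inner_apply]

theorem inner_tfShift_eq_sum_component (z : PhaseSpace d)
    (g f : L2 d (EuclideanSpace ℂ (Fin n))) :
    (inner ℂ (tfShift z g) f : ℂ)
      = ∑ j, inner ℂ (tfShift z (component g j)) (component f j) := by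
  rw [inner_eq_sum_component]
  simp only [component_tfShift]

theorem norm_sq_eq_sum_component (f : L2 d (EuclideanSpace ℂ (Fin n))) :
    ‖f‖ ^ 2 = ∑ j, ‖component f j‖ ^ 2 := by
  apply Complex.ofReal_injective
  have h := inner_eq_sum_component f f
  simp only [inner_self_eq_norm_sq_to_K] at h
  push_cast
  exact h

theorem exists_component_eq (F : Fin n → L2 d ℂ) :
    ∃ f : L2 d (EuclideanSpace ℂ (Fin n)), ∀ j, component f j = F j := by
  have h : MemLp (fun t => (WithLp.toLp 2 fun j => F j t : EuclideanSpace ℂ (Fin n))) 2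
      (volume : Measure (EuclideanSpace ℝ (Fin d))) :=
    MemLp.of_eval_piLp fun j => Lp.memLp (F j)
  refine ⟨h.toLp _, fun j => Lp.ext ?_⟩
  filter_upwards [coeFn_component (h.toLp _) j, h.coeFn_toLp] with t h1 h2
  rw [h1, h2]

end Components

/-! ### Bessel bounds over a lattice and its dual -/

section BesselTransfer

theorem IsBessel.comp_injective {ι κ H : Type*} [NormedAddCommGroup H] [InnerProductSpace ℂ H]
    {φ : ι → H} {B : ℝ} (h : IsBessel φ B) {e : κ → ι} (he : Function.Injective e) :
    IsBessel (fun k => φ (e k)) B := by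
  intro s f
  simpa using h (s.map ⟨e, he⟩) f

theorem enorm_sq_eq_ofReal {E : Type*} [SeminormedAddCommGroup E] (x : E) :
    ‖x‖ₑ ^ 2 = ENNReal.ofReal (‖x‖ ^ 2) := by
  rw [ENNReal.ofReal_pow (norm_nonneg _), ofReal_norm]

theorem sum_enorm_sq_eq_ofReal {ι E : Type*} [SeminormedAddCommGroup E] (s : Finset ι)
    (x : ι → E) : ∑ i ∈ s, ‖x i‖ₑ ^ 2 = ENNReal.ofReal (∑ i ∈ s, ‖x i‖ ^ 2) := by
  rw [ENNReal.ofReal_sum_of_nonneg fun i _ => by positivity]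
  exact Finset.sum_congr rfl fun i _ => enorm_sq_eq_ofReal _

variable {d : ℕ} {ι : Type*} [Finite ι] (b : Module.Basis ι ℝ (PhaseSpace d))

theorem ofReal_volume_fundamentalDomain :
    ENNReal.ofReal (volume.real (ZSpan.fundamentalDomain b))
      = volume (ZSpan.fundamentalDomain b) :=
  ENNReal.ofReal_toReal (volume_fundamentalDomain_lt_top b).ne

theorem volume_real_fundamentalDomain_pos : 0 < volume.real (ZSpan.fundamentalDomain b) :=
  ENNReal.toReal_pos (volume_fundamentalDomain_ne_zero b) (volume_fundamentalDomain_lt_top b).ne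

theorem IsBessel.mono {g : L2 d ℂ} {B : ℝ} {S T : Set (PhaseSpace d)}
    (h : IsBessel (gaborSystem g T) B) (hST : S ⊆ T) : IsBessel (gaborSystem g S) B :=
  h.comp_injective (e := Set.inclusion hST) (Set.inclusion_injective hST)

/-- A Bessel family over a lattice yields a Bessel family over its dual. -/
theorem IsBessel.symplDual {g : L2 d ℂ} {B : ℝ} (hB : 0 ≤ B)
    (h : IsBessel (gaborSystem g (Submodule.span ℤ (Set.range b) : Set (PhaseSpace d))) B) :
    IsBessel (gaborSystem g
      (symplDual (Submodule.span ℤ (Set.range b) : Set (PhaseSpace d))))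
      (B * volume.real (ZSpan.fundamentalDomain b)) := by
  have hv := (volume_real_fundamentalDomain_pos b).le
  refine isBessel_of_synthesis (by positivity) fun s c => ?_
  -- The averaging estimate is used with a single component, indexed by `Unit`.
  have h1 := enorm_sum_tfShift_le b s (fun _ => ()) (fun w => (w : PhaseSpace d))
    (fun w _ => w.2) (fun w _ v _ hwv => Subtype.ext (Prod.ext_iff.1 hwv).2) c (fun _ => g)
    (B := ENNReal.ofReal B) ENNReal.ofReal_ne_top (fun f => by
      rw [ENNReal.tsum_eq_iSup_sum]
      refine iSup_le fun t => ?_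
      simp only [Finset.univ_unique, Finset.sum_singleton]
      rw [sum_enorm_sq_eq_ofReal, enorm_sq_eq_ofReal, ← ENNReal.ofReal_mul hB]
      exact ENNReal.ofReal_le_ofReal (h t _))
  rw [enorm_sq_eq_ofReal, sum_enorm_sq_eq_ofReal, ← ofReal_volume_fundamentalDomain,
    ← ENNReal.ofReal_mul hv, ← ENNReal.ofReal_mul hB, ENNReal.ofReal_le_ofReal_iff
    (mul_nonneg hB (mul_nonneg hv (Finset.sum_nonneg fun _ _ => by positivity))), ← mul_assoc] at h1
  exact h1

/-- A Bessel family over the dual of a lattice yields a Bessel family over the lattice. -/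
theorem exists_isBessel_of_symplDual [DecidableEq ι] :
    ∃ v : ℝ, 0 < v ∧ ∀ (g : L2 d ℂ) (B : ℝ), 0 ≤ B →
      IsBessel (gaborSystem g
        (GaborDuality.symplDual (Submodule.span ℤ (Set.range b) : Set (PhaseSpace d)))) B →
      IsBessel (gaborSystem g (Submodule.span ℤ (Set.range b) : Set (PhaseSpace d))) (B * v) := by
  -- The factor is the volume of a fundamental domain of the dual lattice. Only the inclusion of the
  -- lattice in its double dual is needed.
  refine ⟨_, volume_real_fundamentalDomain_pos (symplBasis b), fun g B hB h => ?_⟩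
  rw [symplDual_span] at h
  have h1 := IsBessel.symplDual (symplBasis b) hB h
  have hsub := subset_symplDual_symplDual
    (Submodule.span ℤ (Set.range b) : Set (PhaseSpace d))
  rw [symplDual_span b] at hsub
  exact h1.mono hsub

end BesselTransfer

/-! ### The two implications -/

section Duality

variable {d n : ℕ} {ι : Type*} [Fintype ι] (b : Module.Basis ι ℝ (PhaseSpace d))

theorem isRieszSequence_iff {J H : Type*} [NormedAddCommGroup H] [InnerProductSpace ℂ H]
    {φ : J → H} : IsRieszSequence φ ↔ ∃ A B : ℝ, 0 < A ∧ 0 < B ∧ HasLowerRieszBound φ A ∧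
      ∀ (s : Finset J) (c : J → ℂ), ‖∑ i ∈ s, c i • φ i‖ ^ 2 ≤ B * ∑ i ∈ s, ‖c i‖ ^ 2 := by
  classical
  constructor
  · rintro ⟨A, B, hA, hB, h⟩
    have key : ∀ (s : Finset J) (c : J → ℂ),
        A * ∑ i ∈ s, ‖c i‖ ^ 2 ≤ ‖∑ i ∈ s, c i • φ i‖ ^ 2 ∧
        ‖∑ i ∈ s, c i • φ i‖ ^ 2 ≤ B * ∑ i ∈ s, ‖c i‖ ^ 2 := by
      intro s c
      let c' : J →₀ ℂ := Finsupp.indicator s fun i _ => c i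
      have hs : c'.support ⊆ s := Finsupp.support_indicator_subset _ _
      have hc : ∀ i ∈ s, c' i = c i := fun i hi => Finsupp.indicator_of_mem hi _
      have e1 : ∑ i ∈ c'.support, ‖c' i‖ ^ 2 = ∑ i ∈ s, ‖c i‖ ^ 2 := by
        rw [Finset.sum_subset hs fun i _ hi => by
          rw [Finsupp.notMem_support_iff.1 hi, norm_zero, zero_pow two_ne_zero]]
        exact Finset.sum_congr rfl fun i hi => by rw [hc i hi]
      have e2 : ∑ i ∈ c'.support, c' i • φ i = ∑ i ∈ s, c i • φ i := by
        rw [Finset.sum_subset hs fun i _ hi => by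
          rw [Finsupp.notMem_support_iff.1 hi, zero_smul]]
        exact Finset.sum_congr rfl fun i hi => by rw [hc i hi]
      have := h c'
      rwa [e1, e2] at this
    exact ⟨A, B, hA, hB, fun s c => (key s c).1, fun s c => (key s c).2⟩
  · rintro ⟨A, B, hA, hB, h1, h2⟩
    exact ⟨A, B, hA, hB, fun c => ⟨h1 c.support c, h2 c.support c⟩⟩

/-- The union of the Gabor systems of the components of `g` over the dual lattice. -/
abbrev dualSystem (g : L2 d (EuclideanSpace ℂ (Fin n))) (S : Set (PhaseSpace d)) :
    Fin n × S → L2 d ℂ :=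
  fun p => gaborSystem (component g p.1) S p.2

theorem isRieszSequence_of_isFrame {g : L2 d (EuclideanSpace ℂ (Fin n))}
    (h : IsFrame (gaborSystem g (Submodule.span ℤ (Set.range b) : Set (PhaseSpace d)))) :
    IsRieszSequence (dualSystem g
      (symplDual (Submodule.span ℤ (Set.range b) : Set (PhaseSpace d)))) := by
  obtain ⟨A, B, hA, hB, h⟩ := h
  have hv := volume_real_fundamentalDomain_pos b
  have hF : ∀ F : Fin n → L2 d ℂ,
      ENNReal.ofReal A * ∑ k, ‖F k‖ₑ ^ 2 ≤ ∑' l : Submodule.span ℤ (Set.range b),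
        ‖∑ k, (inner ℂ (tfShift (l : PhaseSpace d) (component g k)) (F k) : ℂ)‖ₑ ^ 2 ∧
      ∑' l : Submodule.span ℤ (Set.range b),
        ‖∑ k, (inner ℂ (tfShift (l : PhaseSpace d) (component g k)) (F k) : ℂ)‖ₑ ^ 2
        ≤ ENNReal.ofReal B * ∑ k, ‖F k‖ₑ ^ 2 := by
    intro F
    obtain ⟨f, hf⟩ := exists_component_eq F
    obtain ⟨hs, h1, h2⟩ := h f
    have e1 : ∑' l : Submodule.span ℤ (Set.range b),
        ‖∑ k, (inner ℂ (tfShift (l : PhaseSpace d) (component g k)) (F k) : ℂ)‖ₑ ^ 2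
        = ENNReal.ofReal (∑' l, ‖(inner ℂ (gaborSystem g
          (Submodule.span ℤ (Set.range b) : Set (PhaseSpace d)) l) f : ℂ)‖ ^ 2) := by
      rw [ENNReal.ofReal_tsum_of_nonneg (fun l => by positivity) hs]
      refine tsum_congr fun l => ?_
      rw [enorm_sq_eq_ofReal, gaborSystem, inner_tfShift_eq_sum_component]
      simp only [hf]
    have e2 : ∑ k, ‖F k‖ₑ ^ 2 = ENNReal.ofReal (‖f‖ ^ 2) := by
      rw [sum_enorm_sq_eq_ofReal, norm_sq_eq_sum_component]
      simp only [hf]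
    rw [e1, e2, ← ENNReal.ofReal_mul hA.le, ← ENNReal.ofReal_mul hB.le]
    exact ⟨ENNReal.ofReal_le_ofReal h1, ENNReal.ofReal_le_ofReal h2⟩
  refine isRieszSequence_iff.2 ⟨A * volume.real (ZSpan.fundamentalDomain b),
    B * volume.real (ZSpan.fundamentalDomain b), by positivity, by positivity,
    fun s c => ?_, fun s c => ?_⟩
  · have h1 := le_enorm_sum_tfShift b s Prod.fst (fun p => (p.2 : PhaseSpace d))
      (fun p _ => p.2.2) (fun p _ q _ hpq => Prod.ext (Prod.ext_iff.1 hpq).1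
        (Subtype.ext (Prod.ext_iff.1 hpq).2)) c (component g) fun F => (hF F).1
    rw [enorm_sq_eq_ofReal, sum_enorm_sq_eq_ofReal, ← ofReal_volume_fundamentalDomain,
      ← ENNReal.ofReal_mul hv.le, ← ENNReal.ofReal_mul hA.le, ENNReal.ofReal_le_ofReal_iff
      (by positivity), ← mul_assoc] at h1
    exact h1
  · have h1 := enorm_sum_tfShift_le b s Prod.fst (fun p => (p.2 : PhaseSpace d))
      (fun p _ => p.2.2) (fun p _ q _ hpq => Prod.ext (Prod.ext_iff.1 hpq).1
        (Subtype.ext (Prod.ext_iff.1 hpq).2)) c (component g) ENNReal.ofReal_ne_top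
        fun F => (hF F).2
    rw [enorm_sq_eq_ofReal, sum_enorm_sq_eq_ofReal, ← ofReal_volume_fundamentalDomain,
      ← ENNReal.ofReal_mul hv.le, ← ENNReal.ofReal_mul hB.le, ENNReal.ofReal_le_ofReal_iff
      (mul_nonneg hB.le (mul_nonneg hv.le (Finset.sum_nonneg fun _ _ => by positivity))),
      ← mul_assoc] at h1
    exact h1

theorem zero_mem_symplDual (S : Set (PhaseSpace d)) : (0 : PhaseSpace d) ∈ symplDual S :=
  fun l _ => ⟨0, by simp [sympl]⟩

theorem add_mem_symplDual {S : Set (PhaseSpace d)} {w v : PhaseSpace d} (hw : w ∈ symplDual S)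
    (hv : v ∈ symplDual S) : w + v ∈ symplDual S := by
  have h := sub_mem_symplDual hw (sub_mem_symplDual (zero_mem_symplDual S) hv)
  rwa [zero_sub, sub_neg_eq_add] at h

/-- The closed span of Gabor systems over a dual lattice is invariant under its shifts. -/
theorem tfShift_mem_closure_span (g : L2 d (EuclideanSpace ℂ (Fin n))) {S : Set (PhaseSpace d)}
    {w : PhaseSpace d} (hw : w ∈ symplDual S) {v : L2 d ℂ}
    (hv : v ∈ (Submodule.span ℂ (Set.range (dualSystem g (symplDual S)))).topologicalClosure) :
    tfShift w v ∈
      (Submodule.span ℂ (Set.range (dualSystem g (symplDual S)))).topologicalClosure := by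
  have hmap : Set.MapsTo (tfShift w)
      (Submodule.span ℂ (Set.range (dualSystem g (symplDual S))) : Set (L2 d ℂ))
      (Submodule.span ℂ (Set.range (dualSystem g (symplDual S))) : Set (L2 d ℂ)) := by
    intro v hv
    refine Submodule.span_induction ?_ ?_ ?_ ?_ hv
    · rintro _ ⟨⟨k, u⟩, rfl⟩
      have e : tfShift w (dualSystem g (symplDual S) (k, u))
          = char (-inner ℝ (u : PhaseSpace d).2 w.1) •
            dualSystem g (symplDual S) (k, ⟨w + u, add_mem_symplDual hw u.2⟩) :=
        tfShift_tfShift w u (component g k)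
      rw [e]
      exact Submodule.smul_mem _ _ (Submodule.subset_span ⟨_, rfl⟩)
    · have : tfShift w (0 : L2 d ℂ) = 0 := map_zero (tfIsom w)
      rw [this]; exact Submodule.zero_mem _
    · intro x y _ _ hx hy
      rw [tfShift_add]; exact Submodule.add_mem _ hx hy
    · intro a x _ hx
      rw [tfShift_smul]; exact Submodule.smul_mem _ _ hx
  exact hmap.closure (tfIsom w).continuous hv

/-- The dual windows of a Riesz sequence of Gabor systems. -/
theorem exists_dual_windows {g : L2 d (EuclideanSpace ℂ (Fin n))} {S : Set (PhaseSpace d)}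
    {A : ℝ} (hA : 0 < A) (h : HasLowerRieszBound (dualSystem g (symplDual S)) A) :
    ∃ γ : Fin n → L2 d ℂ, (∀ j, IsBessel (gaborSystem (γ j) (symplDual S)) A⁻¹) ∧
      (∀ j, inner ℂ (γ j) (component g j) = (1 : ℂ)) ∧
      (∀ j k, j ≠ k → inner ℂ (γ j) (component g k) = (0 : ℂ)) ∧
      ∀ j k, ∀ w ∈ symplDual S, w ≠ 0 → inner ℂ (γ j) (tfShift w (component g k)) = (0 : ℂ) := by
  let o : symplDual S := ⟨0, zero_mem_symplDual S⟩
  -- Only the vectors biorthogonal to the unshifted `g_j` are chosen; their shifts supply the rest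
  -- of the biorthogonal family.
  choose γ hγV hγ1 hγ0 using fun j : Fin n => h.exists_biorthogonal hA (j, o)
  have ho : ∀ k, dualSystem g (symplDual S) (k, o) = component g k := fun k => tfShift_zero _
  have h1 : ∀ j, inner ℂ (γ j) (component g j) = (1 : ℂ) := fun j => by rw [← ho, hγ1]
  have h0 : ∀ j k, j ≠ k → inner ℂ (γ j) (component g k) = (0 : ℂ) := fun j k hjk => by
    rw [← ho, hγ0 j _ fun e => hjk (Prod.ext_iff.1 e).1.symm]
  have hw : ∀ j k, ∀ w ∈ symplDual S, w ≠ 0 →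
      inner ℂ (γ j) (tfShift w (component g k)) = (0 : ℂ) := fun j k w hwS hw0 =>
    hγ0 j (k, ⟨w, hwS⟩) fun e => hw0 (congrArg Subtype.val (Prod.ext_iff.1 e).2)
  refine ⟨γ, fun j => ?_, h1, h0, hw⟩
  let Γ : Fin n × symplDual S → L2 d ℂ := fun p => tfShift (p.2 : PhaseSpace d) (γ p.1)
  -- The shifts of the `γ_j` stay in the closed span and are biorthogonal to the whole system, so
  -- the lower Riesz bound makes them Bessel.
  have hΓ : IsBessel Γ A⁻¹ := by
    refine h.isBessel_biorthogonal hA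
      (fun p => tfShift_mem_closure_span g p.2.2 (hγV p.1)) (fun p => ?_) (fun p q hpq => ?_)
    · exact (inner_tfShift_tfShift _ _ _).trans (h1 p.1)
    · change inner ℂ (tfShift (p.2 : PhaseSpace d) (γ p.1))
        (tfShift (q.2 : PhaseSpace d) (component g q.1)) = (0 : ℂ)
      rw [inner_tfShift_left, tfShift_tfShift, inner_smul_right]
      have : inner ℂ (γ p.1) (tfShift (-(p.2 : PhaseSpace d) + q.2) (component g q.1))
          = (0 : ℂ) := by
        rcases eq_or_ne (-(p.2 : PhaseSpace d) + q.2) 0 with hz | hz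
        · rw [hz, tfShift_zero]
          refine h0 _ _ fun e => hpq (Prod.ext e.symm (Subtype.ext ?_))
          rw [neg_add_eq_zero] at hz
          exact hz.symm
        · refine hw _ _ _ ?_ hz
          rw [neg_add_eq_sub]
          exact sub_mem_symplDual q.2.2 p.2.2
      rw [this, mul_zero, mul_zero]
  exact hΓ.comp_injective (e := fun w => (j, w)) fun w v hwv => (Prod.ext_iff.1 hwv).2

theorem norm_sum_analysisOp_sq_le {J H : Type*} [NormedAddCommGroup H] [InnerProductSpace ℂ H]
    {φ : Fin n → J → H} {B : ℝ} (hB : 0 ≤ B) (h : ∀ k, IsBessel (φ k) B) (F : Fin n → H) :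
    ‖∑ k, analysisOp hB (h k) (F k)‖ ^ 2 ≤ n * B * ∑ k, ‖F k‖ ^ 2 := by
  calc ‖∑ k, analysisOp hB (h k) (F k)‖ ^ 2 ≤ (∑ k, √B * ‖F k‖) ^ 2 := by
        gcongr
        exact (norm_sum_le _ _).trans
          (Finset.sum_le_sum fun k _ => norm_analysisOp_le hB (h k) (F k))
    _ ≤ n * ∑ k, (√B * ‖F k‖) ^ 2 := by
        simpa using sq_sum_le_card_mul_sum_sq (s := Finset.univ) (f := fun k => √B * ‖F k‖)
    _ = n * B * ∑ k, ‖F k‖ ^ 2 := by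
        simp only [mul_pow, Real.sq_sqrt hB]
        rw [← Finset.mul_sum, mul_assoc]

theorem isFrame_of_isRieszSequence {g : L2 d (EuclideanSpace ℂ (Fin n))}
    (h : IsRieszSequence (dualSystem g
      (symplDual (Submodule.span ℤ (Set.range b) : Set (PhaseSpace d))))) :
    IsFrame (gaborSystem g (Submodule.span ℤ (Set.range b) : Set (PhaseSpace d))) := by
  classical
  obtain ⟨A, B, hA, hB, hlow, hup⟩ := isRieszSequence_iff.1 h
  obtain ⟨γ, hγ, hγ1, hγ0, hγw⟩ := exists_dual_windows hA hlow
  obtain ⟨v, hv, hbes⟩ := exists_isBessel_of_symplDual b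
  obtain ⟨c, hc, hWR⟩ := exists_wexlerRaz_constant b
  have hBv : 0 ≤ B * v := by positivity
  have hAv : 0 ≤ A⁻¹ * v := by positivity
  have hg' : ∀ k, IsBessel (gaborSystem (component g k)
      (Submodule.span ℤ (Set.range b) : Set (PhaseSpace d))) (B * v) := fun k =>
    hbes _ B hB.le ((isBessel_of_synthesis hB.le hup).comp_injective
      (e := fun w => (k, w)) fun w v hwv => (Prod.ext_iff.1 hwv).2)
  have hγ' : ∀ k, IsBessel (gaborSystem (γ k)
      (Submodule.span ℤ (Set.range b) : Set (PhaseSpace d))) (A⁻¹ * v) := fun k =>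
    hbes _ A⁻¹ (by positivity) (hγ k)
  -- The lower constant comes from `c‖f‖² ≤ ‖u‖‖w‖` and `‖w‖² ≤ n A⁻¹ v ‖f‖²`. The added `1` keeps
  -- both constants positive when `n = 0`.
  refine ⟨c ^ 2 / (n * (A⁻¹ * v) + 1), n * (B * v) + 1, by positivity, by positivity,
    fun f => ?_⟩
  set F := component f with hF
  set u := ∑ k, analysisOp hBv (hg' k) (F k) with hu
  set w := ∑ k, analysisOp hAv (hγ' k) (F k) with hw
  have hN : ‖f‖ ^ 2 = ∑ k, ‖F k‖ ^ 2 := norm_sq_eq_sum_component f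
  have hul : ∀ l, u l = inner ℂ (gaborSystem g
      (Submodule.span ℤ (Set.range b) : Set (PhaseSpace d)) l) f := by
    intro l
    rw [gaborSystem, inner_tfShift_eq_sum_component, hu, lp.coeFn_sum, Finset.sum_apply]
    rfl
  have hsum : HasSum (fun l => ‖(inner ℂ (gaborSystem g
      (Submodule.span ℤ (Set.range b) : Set (PhaseSpace d)) l) f : ℂ)‖ ^ 2) (‖u‖ ^ 2) := by
    have := lp.hasSum_norm (p := 2) (by simp) u
    simpa [hul] using this
  have hub := norm_sum_analysisOp_sq_le hBv hg' F
  have hwb := norm_sum_analysisOp_sq_le hAv hγ' F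
  rw [← hu, ← hN] at hub
  rw [← hw, ← hN] at hwb
  -- The Wexler–Raz identity is applied to each pair `(γ_j, g_k)`. Pairs with `j ≠ k` vanish by
  -- biorthogonality, and the diagonal ones add up to `c‖f‖²`.
  have hinner : (inner ℂ u w : ℂ) = ((c * ‖f‖ ^ 2 : ℝ) : ℂ) := by
    rw [hu, hw, sum_inner, hN]
    push_cast
    rw [Finset.mul_sum]
    refine Finset.sum_congr rfl fun k _ => ?_
    rw [inner_sum, Finset.sum_eq_single k]
    · rw [hWR _ _ _ _ _ _ _ _ (hγw k k), hγ1, mul_one, inner_self_eq_norm_sq_to_K]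
      rfl
    · intro j _ hjk
      rw [hWR _ _ _ _ _ _ _ _ (hγw j k), hγ0 j k hjk, mul_zero, mul_zero]
    · intro hk; exact absurd (Finset.mem_univ k) hk
  have hcs : c * ‖f‖ ^ 2 ≤ ‖u‖ * ‖w‖ := by
    have := norm_inner_le_norm (𝕜 := ℂ) u w
    rwa [hinner, Complex.norm_real, Real.norm_of_nonneg (by positivity)] at this
  refine ⟨hsum.summable, ?_, ?_⟩
  · rw [hsum.tsum_eq]
    have hD : 0 < n * (A⁻¹ * v) + 1 := by positivity
    have hwb' : ‖w‖ ^ 2 ≤ (n * (A⁻¹ * v) + 1) * ‖f‖ ^ 2 := by nlinarith [sq_nonneg ‖f‖]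
    rw [div_mul_eq_mul_div, div_le_iff₀ hD]
    rcases (sq_nonneg ‖f‖).eq_or_lt with h0 | h0
    · rw [← h0, mul_zero]; positivity
    · refine le_of_mul_le_mul_right ?_ h0
      calc c ^ 2 * ‖f‖ ^ 2 * ‖f‖ ^ 2 = (c * ‖f‖ ^ 2) ^ 2 := by ring
        _ ≤ (‖u‖ * ‖w‖) ^ 2 := by gcongr
        _ = ‖u‖ ^ 2 * ‖w‖ ^ 2 := by ring
        _ ≤ ‖u‖ ^ 2 * ((n * (A⁻¹ * v) + 1) * ‖f‖ ^ 2) := by gcongr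
        _ = ‖u‖ ^ 2 * (n * (A⁻¹ * v) + 1) * ‖f‖ ^ 2 := by ring
  · rw [hsum.tsum_eq]
    nlinarith [sq_nonneg ‖f‖]

theorem adjointLattice_eq_symplDual (S : Set (PhaseSpace d)) : adjointLattice S = symplDual S :=
  Set.ext fun _ => mem_adjointLattice_iff

theorem exists_basis_span_eq (Λ : Submodule ℤ (PhaseSpace d)) [DiscreteTopology Λ]
    [IsZLattice ℝ Λ] : ∃ (ι : Type) (_ : Fintype ι) (b : Module.Basis ι ℝ (PhaseSpace d)),
      Submodule.span ℤ (Set.range b) = Λ :=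
  ⟨_, inferInstance, (Module.Free.chooseBasis ℤ Λ).ofZLatticeBasis ℝ Λ,
    (Module.Free.chooseBasis ℤ Λ).ofZLatticeBasis_span ℝ⟩

end Duality

end GaborDuality

end

theorem theorem2p7 (d n : ℕ) (Λ : Submodule ℤ (GaborDuality.PhaseSpace d))
    [DiscreteTopology Λ] [IsZLattice ℝ Λ]
    (g : GaborDuality.L2 d (EuclideanSpace ℂ (Fin n))) :
    GaborDuality.IsFrame
        (GaborDuality.gaborSystem g (Λ : Set (GaborDuality.PhaseSpace d))) ↔
      GaborDuality.IsRieszSequence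
        (fun p : Fin n ×
            GaborDuality.adjointLattice (Λ : Set (GaborDuality.PhaseSpace d)) =>
          GaborDuality.gaborSystem (GaborDuality.component g p.1)
            (GaborDuality.adjointLattice (Λ : Set (GaborDuality.PhaseSpace d))) p.2) := by
  obtain ⟨ι, _, b, rfl⟩ := GaborDuality.exists_basis_span_eq Λ
  rw [GaborDuality.adjointLattice_eq_symplDual]
  exact ⟨GaborDuality.isRieszSequence_of_isFrame b, GaborDuality.isFrame_of_isRieszSequence b⟩
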